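/- Let $0<\beta<1/2$, $0\le\theta\le1$, and let $K$ be measurable on $(0,1)$ with $0<K_m\le K(x)\le K_M<\infty$ for almost every $x\in(0,1)$. For $\sigma>0$ put $${}_0^lI_x^{\sigma}w=\frac1{\Gamma(\sigma)}\int_0^x\frac{w(s)}{(x-s)^{1-\sigma}}\,ds,\qquad {}_x^rI_1^{\sigma}w=\frac1{\Gamma(\sigma)}\int_x^1\frac{w(s)}{(s-x)^{1-\sigma}}\,ds,\qquad I^\beta_\theta w=\theta\,{}_0^lI_x^\beta w+(1-\theta)\,{}_x^rI_1^\beta w,$$ and write ${}_0^lI_1^\beta w$ and ${}_0^rI_1^\beta w$ for the values of ${}_0^lI_x^\beta w$ at $x=1$ and of ${}_x^rI_1^\beta w$ at $x=0$. For $\mu>0$ let $H^\mu_0(0,1)$ be the completion of $C_0^\infty(0,1)$ with respect to the norm $\big(\|w\|_{L^2(\mathbb R)}^2+\||\omega|^\mu\mathcal F w\|_{L^2(\mathbb R)}^2\big)^{1/2}$, regarded as a subspace of $L^2(0,1)$; all functions are real valued, and $H^1(0,1)$ is the space of $w\in L^2(0,1)$ with weak derivative $Dw\in L^2(0,1)$.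 All equations between functions below hold almost everywhere on $(0,1)$. Let $w_l,w_r\in H^1(0,1)$ be the weak solutions of $$(K\,Dw_l,Dv)_{L^2(0,1)}=0=(K\,Dw_r,Dv)_{L^2(0,1)}\quad\forall v\in H^1_0(0,1),\qquad w_l(0)=w_r(1)=1,\quad w_l(1)=w_r(0)=0,$$ let $w_l^c(x)=1-x$, $w_r^c(x)=x$, and let $u_l,u_r\in H_0^{1-\beta}(0,1)$ be the solutions of $$I^\beta_\theta u_l-(1-\theta)({}_0^rI^\beta_1u_l)\,w_l^c-\theta({}_0^lI^\beta_1u_l)\,w_r^c=w_l-w_l^c,$$ $$I^\beta_\theta u_r-(1-\theta)({}_0^rI^\beta_1u_r)\,w_l^c-\theta({}_0^lI^\beta_1u_r)\,w_r^c=w_r-w_r^c.$$ Then each of $w_l,w_r,u_l,u_r$ exists and is unique, and the two conditions $$1+\theta\,({}_0^lI^\beta_1u_l)-(1-\theta)\,({}_0^rI^\beta_1u_l)\neq0,\qquad 1-\theta\,({}_0^lI^\beta_1u_r)+(1-\theta)\,({}_0^rI^\beta_1u_r)\neq0$$ are equivalent. If they hold, then the space $$\mathcal V=\Big\{g\in H^1_0(0,1):\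 \exists\,\phi\in H^{1-\beta}_0(0,1),\ \ I^\beta_\theta\phi-(1-\theta)({}_0^rI^\beta_1\phi)\,w_l-\theta({}_0^lI^\beta_1\phi)\,w_r=g\Big\}$$ equals $H^1_0(0,1)$; that is, every $g\in H^1_0(0,1)$ is of the displayed form for some $\phi\in H^{1-\beta}_0(0,1)$. -/

import Mathlib

open MeasureTheory Set
open scoped ContDiff FourierTransform ENNReal

noncomputable section

namespace TwoSidedFDE

/-- Lebesgue measure on the interval `(0,1)`. -/
abbrev vol01 : Measure ℝ := volume.restrict (Ioo (0 : ℝ) 1)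

/-- The real Hilbert space `L²(0,1)` (functions modulo a.e. equality). -/
abbrev L2 : Type := Lp ℝ 2 vol01

/-- Test functions: real functions on the line of class `C^∞`, with compact support
contained in the open interval `(0,1)`. -/
def IsTest (ψ : ℝ → ℝ) : Prop :=
  ContDiff ℝ ∞ ψ ∧ HasCompactSupport ψ ∧ tsupport ψ ⊆ Ioo 0 1

/-- The norm `(‖f‖_{L²(ℝ)}² + ‖|y|^μ (𝓕 f)(y)‖_{L²(ℝ)}²)^{1/2}` of `H^μ(ℝ)`, with values in `[0,∞]`.
It is used only for integrable `f`, so that the Fourier transform is given by its integral. -/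
def sobolevNorm (μ : ℝ) (f : ℝ → ℂ) : ℝ≥0∞ :=
  (eLpNorm f 2 volume ^ 2 +
    eLpNorm (fun y : ℝ => ((|y| ^ μ : ℝ) : ℂ) * 𝓕 f y) 2 volume ^ 2) ^ (1 / 2 : ℝ)

/-- Extension by zero of a function on `(0,1)` to the line. -/
def zeroExt (w : ℝ → ℝ) : ℝ → ℝ := (Ioo (0 : ℝ) 1).indicator w

/-- The space `H^μ_0(0,1)`: the completion of the test functions on `(0,1)` with respect to the norm
of `H^μ(ℝ)`, realised inside `L²(0,1)` as the set of those `w` whose extension by zero is a limit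
of test functions in that norm. -/
def H0 (μ : ℝ) : Set L2 :=
  {w | ∀ ε : ℝ≥0∞, 0 < ε → ∃ ψ : ℝ → ℝ, IsTest ψ ∧
    sobolevNorm μ (fun x => ((zeroExt w x - ψ x : ℝ) : ℂ)) < ε}

/-- `w' ∈ L²(0,1)` is the weak derivative of `w ∈ L²(0,1)`;
`w` belongs to `H¹(0,1)` exactly when such a `w'` exists. -/
def HasWeakDeriv (w w' : L2) : Prop :=
  ∀ ψ : ℝ → ℝ, IsTest ψ → ∫ x, w x * deriv ψ x ∂vol01 = - ∫ x, w' x * ψ x ∂vol01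

/-- The boundary values of `w` are `w(0) = p` and `w(1) = q`: they are those of
the representative of `w` that is continuous on `[0,1]`. -/
def HasBoundaryValues (w : L2) (p q : ℝ) : Prop :=
  ∃ c : ℝ → ℝ, ContinuousOn c (Icc 0 1) ∧ w =ᵐ[vol01] c ∧ c 0 = p ∧ c 1 = q

/-- `w ∈ H¹(0,1)` is a weak solution of `-D(K D w) = 0` with `w(0) = p`, `w(1) = q`,
that is, `(K D w, D v)_{L²(0,1)} = 0` for all `v ∈ H¹_0(0,1)`. -/
def IsWeakSolution (K : ℝ → ℝ) (p q : ℝ) (w : L2) : Prop :=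
  ∃ w' : L2, HasWeakDeriv w w' ∧ HasBoundaryValues w p q ∧
    ∀ v ∈ H0 1, ∀ v' : L2, HasWeakDeriv v v' → ∫ x, K x * w' x * v' x ∂vol01 = 0

/-- The left fractional integral of order `σ` with base point `a`. -/
def leftInt (a σ : ℝ) (w : ℝ → ℝ) (x : ℝ) : ℝ :=
  1 / Real.Gamma σ * ∫ s in a..x, w s / (x - s) ^ (1 - σ)

/-- The right fractional integral of order `σ` with base point `b`. -/
def rightInt (b σ : ℝ) (w : ℝ → ℝ) (x : ℝ) : ℝ :=
  1 / Real.Gamma σ * ∫ s in x..b, w s / (s - x) ^ (1 - σ)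

/-- The two-sided fractional integral `I^β_θ` on `(0,1)`. -/
def twoSidedInt (β θ : ℝ) (w : ℝ → ℝ) (x : ℝ) : ℝ :=
  θ * leftInt 0 β w x + (1 - θ) * rightInt 1 β w x

/-- The function
`I^β_θ φ - (1-θ) (right fractional integral of φ at 0) p - θ (left fractional integral of φ at 1) q`.
-/
def boundaryCorrected (β θ : ℝ) (p q φ : ℝ → ℝ) (x : ℝ) : ℝ :=
  twoSidedInt β θ φ x - (1 - θ) * rightInt 1 β φ 0 * p x - θ * leftInt 0 β φ 1 * q x

/-- `u ∈ H^{1-β}_0(0,1)` solves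
`I^β_θ u - (1-θ) (right integral of u at 0) (1-x) - θ (left integral of u at 1) x = w - wc`. -/
def IsCorrector (β θ : ℝ) (w : L2) (wc : ℝ → ℝ) (u : L2) : Prop :=
  u ∈ H0 (1 - β) ∧
    boundaryCorrected β θ (fun x => 1 - x) (fun x => x) u =ᵐ[vol01] fun x => w x - wc x

/-- The space `𝒱`. -/
def spaceV (β θ : ℝ) (wl wr : L2) : Set L2 :=
  {g | g ∈ H0 1 ∧ ∃ φ ∈ H0 (1 - β), boundaryCorrected β θ wl wr φ =ᵐ[vol01] g}

end TwoSidedFDE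

end

/-!
For a test function `φ` put `a = I^β_left Dφ` and `b = I^β_right Dφ`; up to sign these are the two
fractional derivatives of `φ` of order `1 - β`. In Fourier variables `⟨a, b⟩` is a multiple of
`‖|ω|^(1-β) 𝓕 φ‖²`, positive because `β < 1/2`, and it dominates `‖a‖²` and `‖b‖²`. Hence
`H^{1-β}_0(0,1)` is the domain of the closed operator `φ ↦ (a, b)`, on which the derivative
`L φ = θ a + (1 - θ) b` of `I^β_θ φ` is bounded below. So `L` is injective with closed range, and by
duality `L²(0,1)` is the direct sum of this range and the constants.

An element of `H¹(0,1)` is a constant plus a primitive, and `D w_r = -D w_l = k` is the multiple of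
`1/K` with integral `1`. After differentiation every equation reads `L φ - ⟨1, L φ⟩ k = γ` with `γ`
of mean zero, where `k` is replaced by `1` for the correctors. For `k = 1` there is exactly one
solution; this gives `u_r = -u_l`, hence the equivalence of the two conditions. If `φ` solves the
equation for `k = 1`, then `φ + s u_l` solves it for general `k` when `s (1 + ⟨1, L u_l⟩)` equals
`-⟨1, L φ⟩`, and the condition says that `1 + ⟨1, L u_l⟩` does not vanish.
-/

noncomputable section

namespace TwoSidedFDE

/-- The causal kernel `z_+^(σ-1) / Γ(σ)` of fractional integration of order `σ`. -/
def kappa (σ z : ℝ) : ℝ := (Ioi (0 : ℝ)).indicator (fun z => z ^ (σ - 1) / Real.Gamma σ) z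

lemma kappa_of_pos {σ z : ℝ} (hz : 0 < z) : kappa σ z = z ^ (σ - 1) / Real.Gamma σ :=
  indicator_of_mem (mem_Ioi.2 hz) _

lemma kappa_of_nonpos {σ z : ℝ} (hz : z ≤ 0) : kappa σ z = 0 :=
  indicator_of_notMem (notMem_Ioi.2 hz) _

lemma kappa_nonneg {σ : ℝ} (hσ : 0 < σ) (z : ℝ) : 0 ≤ kappa σ z :=
  indicator_nonneg (fun z (hz : 0 < z) => by have := Real.Gamma_pos_of_pos hσ; positivity) z

@[fun_prop]
lemma measurable_kappa (σ : ℝ) : Measurable (kappa σ) :=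
  (by fun_prop : Measurable fun z : ℝ => z ^ (σ - 1) / Real.Gamma σ).indicator measurableSet_Ioi

lemma kappa_one : kappa 1 = (Ioi (0 : ℝ)).indicator 1 := by
  ext z
  simp [kappa, indicator_apply]

lemma kappa_mul {r : ℝ} (hr : 0 < r) (σ z : ℝ) : kappa σ (r * z) = r ^ (σ - 1) * kappa σ z := by
  rcases le_or_gt z 0 with hz | hz
  · rw [kappa_of_nonpos hz, kappa_of_nonpos (mul_nonpos_of_nonneg_of_nonpos hr.le hz), mul_zero]
  · rw [kappa_of_pos hz, kappa_of_pos (mul_pos hr hz), Real.mul_rpow hr.le hz.le, mul_div_assoc]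

lemma integrable_and_integral_of_eq_rpow_mul_comp {F g : ℝ → ℝ} {r a y : ℝ} (hr : 0 < r)
    (hg : Integrable g) (hF : ∀ t, F t = r ^ (a - 1) * g (r⁻¹ * (t - y))) :
    Integrable F ∧ ∫ t, F t = r ^ a * ∫ u, g u := by
  obtain rfl : F = fun t => r ^ (a - 1) * g (r⁻¹ * (t - y)) := funext hF
  refine ⟨((hg.comp_mul_left' (inv_ne_zero hr.ne')).comp_sub_right y).const_mul _, ?_⟩
  rw [integral_const_mul, integral_sub_right_eq_self (fun t => g (r⁻¹ * t)),
    Measure.integral_comp_inv_mul_left, abs_of_pos hr, smul_eq_mul, ← mul_assoc,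
    ← Real.rpow_add_one hr.ne', sub_add_cancel]

lemma kappa_one_sub_mul_kappa {p q : ℝ} (hp : 0 < p) (hq : 0 < q) (u : ℝ) :
    kappa p (1 - u) * kappa q u =
      (Real.Gamma (p + q))⁻¹ * ProbabilityTheory.betaPDFReal q p u := by
  have := Real.Gamma_pos_of_pos hp
  have := Real.Gamma_pos_of_pos hq
  have := Real.Gamma_pos_of_pos (add_pos hp hq)
  by_cases hu : 0 < u ∧ u < 1
  · rw [ProbabilityTheory.betaPDFReal, if_pos hu, kappa_of_pos hu.1, kappa_of_pos (sub_pos.2 hu.2),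
      ProbabilityTheory.beta, add_comm q p]
    field_simp
  · rw [ProbabilityTheory.betaPDFReal, if_neg hu, mul_zero, mul_eq_zero]
    by_cases h : 0 < u
    · exact .inl (kappa_of_nonpos (by linarith [not_lt.1 fun h1 => hu ⟨h, h1⟩]))
    · exact .inr (kappa_of_nonpos (not_lt.1 h))

lemma integrable_betaPDFReal {p q : ℝ} (hp : 0 < p) (hq : 0 < q) :
    Integrable (ProbabilityTheory.betaPDFReal p q) ∧
      ∫ u, ProbabilityTheory.betaPDFReal p q u = 1 := by
  have hone := ProbabilityTheory.lintegral_betaPDF_eq_one hp hq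
  have h0 : ∀ u, 0 ≤ ProbabilityTheory.betaPDFReal p q u := fun u => by
    by_cases hu : 0 < u ∧ u < 1
    · exact (ProbabilityTheory.betaPDFReal_pos hu.1 hu.2 hp hq).le
    · rw [ProbabilityTheory.betaPDFReal, if_neg hu]
  have hm : AEStronglyMeasurable (ProbabilityTheory.betaPDFReal p q) := by fun_prop
  refine ⟨⟨hm, ?_⟩, ?_⟩
  · rw [hasFiniteIntegral_iff_ofReal (ae_of_all _ h0)]
    exact hone.trans_lt ENNReal.one_lt_top
  · rw [integral_eq_lintegral_of_nonneg_ae (ae_of_all _ h0) hm]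
    exact (congrArg ENNReal.toReal hone).trans ENNReal.toReal_one

lemma integrable_and_integral_kappa_mul_kappa {p q : ℝ} (hp : 0 < p) (hq : 0 < q) (x y : ℝ) :
    Integrable (fun t => kappa p (x - t) * kappa q (t - y)) ∧
      ∫ t, kappa p (x - t) * kappa q (t - y) = kappa (p + q) (x - y) := by
  rcases le_or_gt x y with hxy | hxy
  · have hz : ∀ t, kappa p (x - t) * kappa q (t - y) = 0 := fun t => by
      rcases le_or_gt x t with h | h
      · rw [kappa_of_nonpos (by linarith : x - t ≤ 0), zero_mul]
      · rw [kappa_of_nonpos (by linarith : t - y ≤ 0), mul_zero]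
    simp [hz, kappa_of_nonpos (sub_nonpos.2 hxy)]
  have hr : 0 < x - y := sub_pos.2 hxy
  obtain ⟨hi, hβ⟩ := integrable_betaPDFReal hq hp
  have key := integrable_and_integral_of_eq_rpow_mul_comp (a := p + q - 1) (y := y) hr
    (hi.const_mul (Real.Gamma (p + q))⁻¹) (F := fun t => kappa p (x - t) * kappa q (t - y))
    fun t => by
      rw [← kappa_one_sub_mul_kappa hp hq,
        show x - t = (x - y) * (1 - (x - y)⁻¹ * (t - y)) by field_simp; ring,
        show t - y = (x - y) * ((x - y)⁻¹ * (t - y)) by field_simp, kappa_mul hr, kappa_mul hr,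
        show p + q - 1 - 1 = (p - 1) + (q - 1) by ring, Real.rpow_add hr]
      field_simp
  refine ⟨key.1, key.2.trans ?_⟩
  rw [integral_const_mul, hβ, mul_one, kappa_of_pos hr, div_eq_mul_inv]

lemma integrable_kappa_mul_kappa_add_one {β : ℝ} (h0 : 0 < β) (h1 : β < 1 / 2) :
    Integrable fun u => kappa β u * kappa β (u + 1) := by
  have hle : ∀ {u v : ℝ}, 0 < u → 0 < v → v ≤ u + 1 →
      ‖kappa β u * kappa β (u + 1)‖ ≤ u ^ (β - 1) * v ^ (β - 1) / Real.Gamma β ^ 2 := by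
    intro u v hu hv hvu
    have := Real.Gamma_pos_of_pos h0
    have hmono : (u + 1) ^ (β - 1) ≤ v ^ (β - 1) :=
      Real.rpow_le_rpow_of_nonpos hv hvu (by linarith)
    rw [Real.norm_of_nonneg (mul_nonneg (kappa_nonneg h0 _) (kappa_nonneg h0 _)), kappa_of_pos hu,
      kappa_of_pos (by linarith), div_mul_div_comm, ← pow_two]
    gcongr
  have hm : Measurable fun u => kappa β u * kappa β (u + 1) := by fun_prop
  have hsupp : ∀ u ∉ Ioi (0 : ℝ), kappa β u * kappa β (u + 1) = 0 := fun u hu => by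
    rw [kappa_of_nonpos (notMem_Ioi.1 hu), zero_mul]
  refine (integrableOn_iff_integrable_of_support_subset
    (Function.support_subset_iff'.2 hsupp)).1 ?_
  rw [← Ioc_union_Ioi_eq_Ioi zero_le_one]
  refine IntegrableOn.union ?_ ?_
  · have hi : IntegrableOn (fun u : ℝ => u ^ (β - 1) * 1 ^ (β - 1) / Real.Gamma β ^ 2) (Ioc 0 1) :=
      ((intervalIntegral.intervalIntegrable_rpow' (a := 0) (b := 1)
        (by linarith : -1 < β - 1)).1.mul_const _).div_const _
    exact hi.mono' hm.aestronglyMeasurable <| (ae_restrict_iff' measurableSet_Ioc).2 <|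
      ae_of_all _ fun u hu => hle hu.1 one_pos (by linarith [hu.1])
  · have hi : IntegrableOn (fun u : ℝ => u ^ (2 * β - 2) / Real.Gamma β ^ 2) (Ioi 1) :=
      (integrableOn_Ioi_rpow_of_lt (by linarith) one_pos).div_const _
    refine hi.mono' hm.aestronglyMeasurable <| (ae_restrict_iff' measurableSet_Ioi).2 <|
      ae_of_all _ fun u (hu : 1 < u) => ?_
    rw [show 2 * β - 2 = (β - 1) + (β - 1) by ring, Real.rpow_add (by linarith)]
    exact hle (by linarith) (by linarith) (by linarith)

lemma exists_integral_kappa_mul_kappa_self {β : ℝ} (h0 : 0 < β) (h1 : β < 1 / 2) :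
    ∃ c : ℝ, ∀ x y : ℝ, x ≠ y →
      Integrable (fun t => kappa β (t - x) * kappa β (t - y)) ∧
      ∫ t, kappa β (t - x) * kappa β (t - y) =
        c * (kappa (2 * β) (x - y) + kappa (2 * β) (y - x)) := by
  have : 0 < Real.Gamma (2 * β) := Real.Gamma_pos_of_pos (by linarith)
  set I := ∫ u, kappa β u * kappa β (u + 1)
  have main : ∀ x y : ℝ, y < x → Integrable (fun t => kappa β (t - x) * kappa β (t - y)) ∧
      ∫ t, kappa β (t - x) * kappa β (t - y) =
        I * Real.Gamma (2 * β) * (kappa (2 * β) (x - y) + kappa (2 * β) (y - x)) := by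
    intro x y hxy
    have hr : 0 < x - y := sub_pos.2 hxy
    have key := integrable_and_integral_of_eq_rpow_mul_comp (a := 2 * β - 1) (y := x) hr
      (integrable_kappa_mul_kappa_add_one h0 h1)
      (F := fun t => kappa β (t - x) * kappa β (t - y)) fun t => by
        rw [show t - x = (x - y) * ((x - y)⁻¹ * (t - x)) by field_simp,
          show t - y = (x - y) * ((x - y)⁻¹ * (t - x) + 1) by field_simp; ring, kappa_mul hr,
          kappa_mul hr, show 2 * β - 1 - 1 = (β - 1) + (β - 1) by ring, Real.rpow_add hr]
        field_simp
    refine ⟨key.1, key.2.trans ?_⟩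
    rw [kappa_of_pos hr, kappa_of_nonpos (by linarith : y - x ≤ 0)]
    field_simp
    ring
  refine ⟨I * Real.Gamma (2 * β), fun x y hxy => ?_⟩
  rcases lt_or_gt_of_ne hxy with h | h
  · simp_rw [mul_comm (kappa β (_ - x)), add_comm (kappa (2 * β) (x - y))]
    exact main y x h
  · exact main x y h

section Fubini

variable {T Z : Type*} [MeasurableSpace T] [MeasurableSpace Z] {μ : Measure T} [SFinite μ]
  {ν : Measure Z} [SFinite ν] {k : T → Z → ℝ} {F : Z → ℝ}

lemma integrable_kernel_mul (hk : Measurable (Function.uncurry k)) (hk0 : ∀ t z, 0 ≤ k t z)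
    (hki : ∀ᵐ z ∂ν, Integrable (fun t => k t z) μ) (hF : AEStronglyMeasurable F ν)
    (hkF : Integrable (fun z => (∫ t, k t z ∂μ) * F z) ν) :
    Integrable (fun p : T × Z => k p.1 p.2 * F p.2) (μ.prod ν) := by
  have hmeas : AEStronglyMeasurable (fun p : T × Z => k p.1 p.2 * F p.2) (μ.prod ν) :=
    hk.aestronglyMeasurable.mul hF.comp_snd
  rw [integrable_prod_iff' hmeas]
  refine ⟨hki.mono fun z hz => hz.mul_const (F z), hkF.norm.congr (ae_of_all _ fun z => ?_)⟩
  simp only [norm_mul, integral_mul_const, Real.norm_of_nonneg (hk0 _ z),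
    Real.norm_of_nonneg (integral_nonneg fun t => hk0 t z)]

lemma integral_integral_kernel_mul (hk : Measurable (Function.uncurry k)) (hk0 : ∀ t z, 0 ≤ k t z)
    (hki : ∀ᵐ z ∂ν, Integrable (fun t => k t z) μ) (hF : AEStronglyMeasurable F ν)
    (hkF : Integrable (fun z => (∫ t, k t z ∂μ) * F z) ν) :
    ∫ t, ∫ z, k t z * F z ∂ν ∂μ = ∫ z, (∫ t, k t z ∂μ) * F z ∂ν := by
  rw [integral_integral_swap (integrable_kernel_mul hk hk0 hki hF hkF)]
  simp only [integral_mul_const]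

end Fubini

lemma integral_mul_integral_kernel_mul {k₁ k₂ : ℝ → ℝ → ℝ} {m : ℝ × ℝ → ℝ} {f g : ℝ → ℝ}
    (hk₁ : Measurable (Function.uncurry k₁)) (hk₂ : Measurable (Function.uncurry k₂))
    (hk₁0 : ∀ t x, 0 ≤ k₁ t x) (hk₂0 : ∀ t x, 0 ≤ k₂ t x)
    (hm : ∀ᵐ z : ℝ × ℝ, Integrable (fun t => k₁ t z.1 * k₂ t z.2) ∧
      ∫ t, k₁ t z.1 * k₂ t z.2 = m z)
    (hf : AEStronglyMeasurable f) (hg : AEStronglyMeasurable g)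
    (hmF : Integrable fun z : ℝ × ℝ => m z * (f z.1 * g z.2)) :
    Integrable (fun t => (∫ x, k₁ t x * f x) * ∫ y, k₂ t y * g y) ∧
    ∫ t, (∫ x, k₁ t x * f x) * ∫ y, k₂ t y * g y = ∫ z : ℝ × ℝ, m z * (f z.1 * g z.2) := by
  have hk : Measurable (Function.uncurry fun (t : ℝ) (z : ℝ × ℝ) => k₁ t z.1 * k₂ t z.2) :=
    (hk₁.comp (measurable_fst.prodMk (measurable_fst.comp measurable_snd))).mul
      (hk₂.comp (measurable_fst.prodMk (measurable_snd.comp measurable_snd)))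
  have hk0 : ∀ (t : ℝ) (z : ℝ × ℝ), 0 ≤ k₁ t z.1 * k₂ t z.2 :=
    fun t z => mul_nonneg (hk₁0 _ _) (hk₂0 _ _)
  have hF : AEStronglyMeasurable fun z : ℝ × ℝ => f z.1 * g z.2 := hf.comp_fst.mul hg.comp_snd
  have hm_eq : (fun z => m z * (f z.1 * g z.2)) =ᵐ[volume]
      fun z => (∫ t, k₁ t z.1 * k₂ t z.2) * (f z.1 * g z.2) :=
    hm.mono fun z hz => by simp only [hz.2]
  have hprod : ∀ t, (∫ x, k₁ t x * f x) * ∫ y, k₂ t y * g y =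
      ∫ z : ℝ × ℝ, (k₁ t z.1 * k₂ t z.2) * (f z.1 * g z.2) := fun t => by
    rw [← integral_prod_mul]
    exact integral_congr_ae (ae_of_all _ fun z => by ring)
  have hki := hm.mono fun z hz => hz.1
  simp_rw [hprod, integral_congr_ae hm_eq]
  exact ⟨(integrable_kernel_mul (μ := volume) hk hk0 hki hF (hmF.congr hm_eq)).integral_prod_left,
    integral_integral_kernel_mul hk hk0 hki hF (hmF.congr hm_eq)⟩

lemma integrable_kernel_mul_mul {k f g : ℝ → ℝ} (hk : Integrable k) (hf : MemLp f 2)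
    (hg : MemLp g 2) : Integrable fun z : ℝ × ℝ => k (z.1 - z.2) * (f z.1 * g z.2) := by
  have hsnd : Integrable fun z : ℝ × ℝ => k (z.1 - z.2) * g z.2 ^ 2 := by
    simpa [mul_comm, Measure.volume_eq_prod] using
      hg.integrable_sq.convolution_integrand (ContinuousLinearMap.mul ℝ ℝ) hk
  have hfst : Integrable fun z : ℝ × ℝ => k (z.1 - z.2) * f z.1 ^ 2 := by
    simpa [mul_comm, Function.comp_def, Measure.volume_eq_prod] using
      (hf.integrable_sq.convolution_integrand (ContinuousLinearMap.mul ℝ ℝ) hk.comp_neg).swap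
  have hm : AEStronglyMeasurable fun z : ℝ × ℝ => k (z.1 - z.2) :=
    hk.1.comp_quasiMeasurePreserving (quasiMeasurePreserving_sub_of_right_invariant volume volume)
  refine (hfst.norm.add hsnd.norm).mono' (hm.mul (hf.1.comp_fst.mul hg.1.comp_snd))
    (ae_of_all _ fun z => ?_)
  have hfg : ‖f z.1 * g z.2‖ ≤ f z.1 ^ 2 + g z.2 ^ 2 := by
    rw [Real.norm_eq_abs, abs_le]
    constructor <;> nlinarith [sq_nonneg (f z.1 + g z.2), sq_nonneg (f z.1 - g z.2)]
  simp only [norm_mul, norm_pow, Real.norm_eq_abs, sq_abs, Pi.add_apply, ← mul_add] at hfg ⊢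
  gcongr

lemma exists_kappa_eq_add {σ : ℝ} (h0 : 0 < σ) (h1 : σ ≤ 1) :
    ∃ k₁ k₂ : ℝ → ℝ, Integrable k₁ ∧ Measurable k₂ ∧ (∃ C, ∀ z, ‖k₂ z‖ ≤ C) ∧
      kappa σ = k₁ + k₂ := by
  have := Real.Gamma_pos_of_pos h0
  refine ⟨(Iic 1).indicator (kappa σ), (Iic 1)ᶜ.indicator (kappa σ), ?_,
    (measurable_kappa σ).indicator measurableSet_Iic.compl, ⟨(Real.Gamma σ)⁻¹, fun z => ?_⟩,
    (indicator_self_add_compl _ _).symm⟩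
  · have hi : IntegrableOn (fun z : ℝ => z ^ (σ - 1) / Real.Gamma σ) (Ioc 0 1) :=
      (intervalIntegral.intervalIntegrable_rpow' (by linarith)).1.div_const _
    rw [← Ioi_inter_Iic, inter_comm] at hi
    rw [← integrable_indicator_iff (measurableSet_Iic.inter measurableSet_Ioi),
      ← indicator_indicator] at hi
    exact hi
  · by_cases hz : z ≤ 1
    · rw [indicator_of_notMem (by simpa using hz), norm_zero]
      positivity
    · rw [indicator_of_mem (by simpa using hz), Real.norm_of_nonneg (kappa_nonneg h0 _),
        kappa_of_pos (by linarith), div_eq_mul_inv]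
      exact mul_le_of_le_one_left (by positivity)
        (Real.rpow_le_one_of_one_le_of_nonpos (by linarith) (by linarith))

lemma integrable_kappa_mul_mul {σ : ℝ} (h0 : 0 < σ) (h1 : σ ≤ 1) {f g : ℝ → ℝ}
    (hf : Integrable f) (hf2 : MemLp f 2) (hg : Integrable g) (hg2 : MemLp g 2) :
    Integrable fun z : ℝ × ℝ => kappa σ (z.1 - z.2) * (f z.1 * g z.2) := by
  obtain ⟨k₁, k₂, hk₁, hk₂, ⟨C, hC⟩, hk⟩ := exists_kappa_eq_add h0 h1
  simp only [hk, Pi.add_apply, add_mul]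
  exact (integrable_kernel_mul_mul hk₁ hf2 hg2).add ((hf.mul_prod hg).bdd_mul
    (hk₂.comp (measurable_fst.sub measurable_snd)).aestronglyMeasurable
    (ae_of_all _ fun z => hC (z.1 - z.2)))

/-- The left fractional integral of order `σ` with base point `-∞`. -/
def leftI (σ : ℝ) (f : ℝ → ℝ) (x : ℝ) : ℝ := ∫ s, kappa σ (x - s) * f s

/-- The right fractional integral of order `σ` with base point `∞`. -/
def rightI (σ : ℝ) (f : ℝ → ℝ) (x : ℝ) : ℝ := ∫ s, kappa σ (s - x) * f s

/-- The quadratic form `⟨f, leftI σ f⟩` of fractional integration, written as a double integral;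
it is a multiple of the square of the homogeneous Sobolev norm of `f` of order `-σ / 2`. -/
def energy (σ : ℝ) (f : ℝ → ℝ) : ℝ :=
  ∫ z : ℝ × ℝ, kappa σ (z.1 - z.2) * (f z.1 * f z.2)

lemma rightI_eq_leftI_comp_neg (σ : ℝ) (f : ℝ → ℝ) (x : ℝ) :
    rightI σ f x = leftI σ (fun s => f (-s)) (-x) := by
  rw [rightI, ← integral_neg_eq_self]
  simp only [leftI, neg_sub_comm _ x]

lemma energy_comp_neg (σ : ℝ) (f : ℝ → ℝ) : energy σ (fun s => f (-s)) = energy σ f := by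
  rw [energy, energy, Measure.volume_eq_prod, ← integral_prod_swap, ← Measure.volume_eq_prod,
    ← integral_neg_eq_self]
  simp [neg_add_eq_sub, mul_comm]

section Adjoint

variable {σ : ℝ} (h0 : 0 < σ) (h1 : σ ≤ 1) {f g : ℝ → ℝ}
  (hf : Integrable f) (hf2 : MemLp f 2) (hg : Integrable g) (hg2 : MemLp g 2)

include h0 h1 hf hf2 hg hg2

lemma integral_mul_leftI_eq_prod :
    ∫ x, f x * leftI σ g x = ∫ z : ℝ × ℝ, kappa σ (z.1 - z.2) * (f z.1 * g z.2) := by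
  rw [Measure.volume_eq_prod, integral_prod _ (integrable_kappa_mul_mul h0 h1 hf hf2 hg hg2)]
  simp only [leftI, ← integral_const_mul, mul_left_comm]

lemma integral_mul_leftI : ∫ x, f x * leftI σ g x = ∫ y, g y * rightI σ f y := by
  rw [integral_mul_leftI_eq_prod h0 h1 hf hf2 hg hg2, Measure.volume_eq_prod,
    integral_prod_symm _ (integrable_kappa_mul_mul h0 h1 hf hf2 hg hg2)]
  simp only [rightI, ← integral_const_mul]
  congr! 4
  ring

end Adjoint

lemma integral_mul_leftI_self {σ : ℝ} (h0 : 0 < σ) (h1 : σ ≤ 1) {f : ℝ → ℝ}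
    (hf : Integrable f) (hf2 : MemLp f 2) : ∫ x, f x * leftI σ f x = energy σ f :=
  integral_mul_leftI_eq_prod h0 h1 hf hf2 hf hf2

lemma integral_rightI_mul_leftI {β : ℝ} (h0 : 0 < β) (h1 : β < 1 / 2) {f : ℝ → ℝ}
    (hf : Integrable f) (hf2 : MemLp f 2) :
    Integrable (fun t => rightI β f t * leftI β f t) ∧
      ∫ t, rightI β f t * leftI β f t = energy (2 * β) f := by
  refine integral_mul_integral_kernel_mul (k₁ := fun t x => kappa β (x - t))
    (k₂ := fun t y => kappa β (t - y)) (by fun_prop) (by fun_prop)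
    (fun _ _ => kappa_nonneg h0 _) (fun _ _ => kappa_nonneg h0 _) (ae_of_all _ fun z => ?_)
    hf.1 hf.1 (integrable_kappa_mul_mul (by linarith) (by linarith) hf hf2 hf hf2)
  rw [two_mul]
  exact integrable_and_integral_kappa_mul_kappa h0 h0 z.1 z.2

lemma ae_fst_ne_snd : ∀ᵐ z : ℝ × ℝ, z.1 ≠ z.2 :=
  (Measure.ae_prod_iff_ae_ae (measurableSet_eq_fun measurable_fst measurable_snd).compl).2
    (ae_of_all _ fun x => (Measure.ae_ne volume x).mono fun _ => Ne.symm)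

lemma integral_kappa_add_kappa_mul {σ : ℝ} (h0 : 0 < σ) (h1 : σ ≤ 1) {f : ℝ → ℝ}
    (hf : Integrable f) (hf2 : MemLp f 2) :
    Integrable (fun z : ℝ × ℝ =>
      (kappa σ (z.1 - z.2) + kappa σ (z.2 - z.1)) * (f z.1 * f z.2)) ∧
    ∫ z : ℝ × ℝ, (kappa σ (z.1 - z.2) + kappa σ (z.2 - z.1)) * (f z.1 * f z.2) =
      2 * energy σ f := by
  have hint := integrable_kappa_mul_mul h0 h1 hf hf2 hf hf2
  have hswap : (fun z : ℝ × ℝ => kappa σ (z.2 - z.1) * (f z.1 * f z.2)) =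
      (fun z : ℝ × ℝ => kappa σ (z.1 - z.2) * (f z.1 * f z.2)) ∘ Prod.swap := by
    ext z
    simp [mul_comm (f z.1)]
  have hint' : Integrable fun z : ℝ × ℝ => kappa σ (z.2 - z.1) * (f z.1 * f z.2) :=
    hswap ▸ hint.swap
  have henergy : ∫ z : ℝ × ℝ, kappa σ (z.2 - z.1) * (f z.1 * f z.2) = energy σ f := by
    rw [hswap]
    exact integral_prod_swap (fun z : ℝ × ℝ => kappa σ (z.1 - z.2) * (f z.1 * f z.2))
  simp only [add_mul]
  refine ⟨hint.add hint', ?_⟩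
  rw [integral_add hint hint', henergy, ← energy, two_mul]

lemma exists_integral_leftI_sq {β : ℝ} (h0 : 0 < β) (h1 : β < 1 / 2) :
    ∃ c : ℝ, ∀ f : ℝ → ℝ, Integrable f → MemLp f 2 →
      MemLp (leftI β f) 2 ∧ ∫ t, leftI β f t ^ 2 = c * energy (2 * β) f := by
  obtain ⟨c, hc⟩ := exists_integral_kappa_mul_kappa_self h0 h1
  refine ⟨c * 2, fun f hf hf2 => ?_⟩
  obtain ⟨hint, henergy⟩ :=
    integral_kappa_add_kappa_mul (σ := 2 * β) (by linarith) (by linarith) hf hf2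
  have key := integral_mul_integral_kernel_mul (k₁ := fun t x => kappa β (t - x))
    (k₂ := fun t y => kappa β (t - y)) (by fun_prop) (by fun_prop)
    (fun _ _ => kappa_nonneg h0 _) (fun _ _ => kappa_nonneg h0 _)
    (ae_fst_ne_snd.mono fun z hz => hc z.1 z.2 hz) hf.1 hf.1
    (by simpa only [mul_assoc] using hint.const_mul c)
  simp only [mul_assoc c, integral_const_mul, henergy, ← pow_two] at key
  refine ⟨(memLp_two_iff_integrable_sq ?_).2 key.1, key.2.trans (by ring)⟩
  have hm : AEStronglyMeasurable (fun p : ℝ × ℝ => kappa β (p.1 - p.2) * f p.2) :=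
    (by fun_prop : Measurable fun p : ℝ × ℝ => kappa β (p.1 - p.2)).aestronglyMeasurable.mul
      hf.1.comp_snd
  exact hm.integral_prod_right'

lemma exists_integral_rightI_sq {β : ℝ} (h0 : 0 < β) (h1 : β < 1 / 2) :
    ∃ c : ℝ, ∀ f : ℝ → ℝ, Integrable f → MemLp f 2 →
      MemLp (rightI β f) 2 ∧ ∫ t, rightI β f t ^ 2 = c * energy (2 * β) f := by
  obtain ⟨c, hc⟩ := exists_integral_leftI_sq h0 h1
  refine ⟨c, fun f hf hf2 => ?_⟩
  have hneg := Measure.measurePreserving_neg (volume : Measure ℝ)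
  obtain ⟨hL, hI⟩ := hc _ hf.comp_neg (hf2.comp_measurePreserving hneg)
  rw [funext (rightI_eq_leftI_comp_neg β f), ← energy_comp_neg, ← hI]
  exact ⟨hL.comp_measurePreserving hneg, integral_neg_eq_self (fun t => leftI β _ t ^ 2) _⟩

lemma leftI_leftI {p q x : ℝ} (hp : 0 < p) (hq : 0 < q) {f : ℝ → ℝ} (hf : AEStronglyMeasurable f)
    (hfx : Integrable fun s => kappa (p + q) (x - s) * f s) :
    leftI p (leftI q f) x = leftI (p + q) f x := by
  have hk := integrable_and_integral_kappa_mul_kappa hp hq x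
  simp only [leftI, ← integral_const_mul, ← mul_assoc]
  rw [integral_integral_kernel_mul (k := fun t s => kappa p (x - t) * kappa q (t - s))
    (by fun_prop) (fun _ _ => mul_nonneg (kappa_nonneg hp _) (kappa_nonneg hq _))
    (ae_of_all _ fun s => (hk s).1) hf (by simpa only [(hk _).2] using hfx)]
  simp only [(hk _).2]

lemma norm_sq_fourier_ofReal (f : ℝ → ℝ) (ξ : ℝ) :
    ((‖𝓕 (fun x => (f x : ℂ)) ξ‖ ^ 2 : ℝ) : ℂ) = ∫ z : ℝ × ℝ,
      Complex.exp (((-2 * Real.pi * ξ * (z.1 - z.2) : ℝ) : ℂ) * Complex.I) *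
        ((f z.1 * f z.2 : ℝ) : ℂ) := by
  rw [Complex.ofReal_pow, ← Complex.mul_conj', Real.fourier_real_eq_integral_exp_smul,
    ← integral_conj, ← integral_prod_mul, Measure.volume_eq_prod]
  congr 1 with z
  simp only [smul_eq_mul, map_mul, ← Complex.exp_conj, Complex.conj_I, Complex.conj_ofReal]
  rw [mul_mul_mul_comm, ← Complex.exp_add]
  push_cast
  ring_nf

lemma integral_fourier_sub_mul {g : ℝ → ℂ} (hg : Integrable g) {f : ℝ → ℝ} (hf : Integrable f) :
    ∫ z : ℝ × ℝ, 𝓕 g (z.1 - z.2) * ((f z.1 * f z.2 : ℝ) : ℂ) =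
      ∫ ξ, g ξ * ((‖𝓕 (fun x => (f x : ℂ)) ξ‖ ^ 2 : ℝ) : ℂ) := by
  have hint : Integrable (fun p : ℝ × (ℝ × ℝ) =>
      Complex.exp (((-2 * Real.pi * p.1 * (p.2.1 - p.2.2) : ℝ) : ℂ) * Complex.I) *
        (g p.1 * ((f p.2.1 * f p.2.2 : ℝ) : ℂ))) (volume.prod volume) :=
    (hg.mul_prod (hf.mul_prod hf).ofReal).bdd_mul (c := 1) (by fun_prop)
      (ae_of_all _ fun p => (Complex.norm_exp_ofReal_mul_I _).le)
  simp only [norm_sq_fourier_ofReal, ← integral_const_mul, mul_left_comm (g _)]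
  rw [integral_integral_swap hint]
  simp only [Real.fourier_real_eq_integral_exp_smul, ← integral_mul_const, smul_eq_mul, mul_assoc]

lemma continuous_fourier_ofReal {f : ℝ → ℝ} (hf : Integrable f) :
    Continuous (𝓕 fun x => (f x : ℂ)) :=
  VectorFourier.fourierIntegral_continuous Real.continuous_fourierChar continuous_inner hf.ofReal

lemma norm_fourier_ofReal_le (f : ℝ → ℝ) (ξ : ℝ) :
    ‖𝓕 (fun x => (f x : ℂ)) ξ‖ ≤ ∫ x, ‖f x‖ :=
  (VectorFourier.norm_fourierIntegral_le_integral_norm _ _ _ _ _).trans_eq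
    (by simp only [Complex.norm_real])

lemma fourier_gaussian_div {t : ℝ} (ht : 0 < t) (z : ℝ) :
    𝓕 (fun ξ : ℝ => ((Real.exp (-(Real.pi * ξ ^ 2 / t)) : ℝ) : ℂ)) z =
      ((t ^ (1 / 2 : ℝ) * Real.exp (-(Real.pi * z ^ 2 * t)) : ℝ) : ℂ) := by
  have h := congrFun (fourier_gaussian_pi (b := ((t⁻¹ : ℝ) : ℂ)) (by simpa using ht)) z
  have hcpow : 1 / ((t⁻¹ : ℝ) : ℂ) ^ (1 / 2 : ℂ) = ((t ^ (1 / 2 : ℝ) : ℝ) : ℂ) := by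
    rw [one_div, show (1 / 2 : ℂ) = ((1 / 2 : ℝ) : ℂ) by push_cast; rfl,
      ← Complex.ofReal_cpow (by positivity), Real.inv_rpow ht.le, Complex.ofReal_inv, inv_inv]
  rw [hcpow] at h
  convert h using 2
  · ext ξ
    push_cast
    ring_nf
  · push_cast
    rw [div_inv_eq_mul]
    ring_nf

lemma integral_gaussian_sub_mul {t : ℝ} (ht : 0 < t) {f : ℝ → ℝ} (hf : Integrable f) :
    Integrable (fun ξ => Real.exp (-(Real.pi * ξ ^ 2 / t)) * ‖𝓕 (fun x => (f x : ℂ)) ξ‖ ^ 2) ∧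
    ∫ z : ℝ × ℝ, Real.exp (-(Real.pi * (z.1 - z.2) ^ 2 * t)) * (f z.1 * f z.2) =
      t ^ (-(1 / 2) : ℝ) *
        ∫ ξ, Real.exp (-(Real.pi * ξ ^ 2 / t)) * ‖𝓕 (fun x => (f x : ℂ)) ξ‖ ^ 2 := by
  have hg : Integrable fun ξ : ℝ => Real.exp (-(Real.pi * ξ ^ 2 / t)) := by
    simpa only [neg_mul, div_mul_eq_mul_div] using
      integrable_exp_neg_mul_sq (div_pos Real.pi_pos ht)
  have hF := continuous_fourier_ofReal hf
  refine ⟨hg.mul_bdd (c := (∫ x, ‖f x‖) ^ 2) (by fun_prop) (ae_of_all _ fun ξ => ?_), ?_⟩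
  · rw [norm_pow, norm_norm]
    exact pow_le_pow_left₀ (norm_nonneg _) (norm_fourier_ofReal_le f ξ) 2
  · have h := integral_fourier_sub_mul
      (g := fun ξ => ((Real.exp (-(Real.pi * ξ ^ 2 / t)) : ℝ) : ℂ)) hg.ofReal hf
    simp only [fourier_gaussian_div ht, ← Complex.ofReal_mul, integral_complex_ofReal, mul_assoc,
      integral_const_mul, Complex.ofReal_inj] at h
    rw [← h, ← mul_assoc, ← Real.rpow_add ht]
    norm_num [mul_assoc]

lemma integrable_and_integral_kappa_mul_exp {σ r : ℝ} (hσ : 0 < σ) (hr : 0 < r) :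
    Integrable (fun t => kappa σ t * Real.exp (-(r * t))) ∧
      ∫ t, kappa σ t * Real.exp (-(r * t)) = r ^ (-σ) := by
  have hΓ := Real.Gamma_pos_of_pos hσ
  have hval : ∫ t in Ioi (0 : ℝ), t ^ (σ - 1) * Real.exp (-(r * t)) = r ^ (-σ) * Real.Gamma σ := by
    rw [Real.integral_rpow_mul_exp_neg_mul_Ioi hσ hr, one_div, Real.inv_rpow hr.le,
      Real.rpow_neg hr.le]
  have hint : IntegrableOn (fun t : ℝ => t ^ (σ - 1) * Real.exp (-(r * t))) (Ioi 0) :=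
    of_not_not fun h => (by positivity : r ^ (-σ) * Real.Gamma σ ≠ 0) (hval ▸ integral_undef h)
  have hk : (fun t => kappa σ t * Real.exp (-(r * t))) = (Ioi (0 : ℝ)).indicator
      fun t => t ^ (σ - 1) * Real.exp (-(r * t)) / Real.Gamma σ := by
    ext t
    simp only [kappa, indicator_apply, ite_mul, zero_mul, div_mul_eq_mul_div]
  rw [hk, integrable_indicator_iff measurableSet_Ioi, integral_indicator measurableSet_Ioi,
    integral_div, hval, mul_div_cancel_right₀ _ hΓ.ne']
  exact ⟨hint.div_const _, rfl⟩

lemma integrable_and_integral_kappa_mul_rpow_mul_exp_div {a s r : ℝ} (ha : 0 < a) (hr : 0 < r) :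
    Integrable (fun t => kappa s t * (t ^ (-a - s) * Real.exp (-(r / t)))) ∧
      ∫ t, kappa s t * (t ^ (-a - s) * Real.exp (-(r / t))) =
        Real.Gamma a / Real.Gamma s * r ^ (-a) := by
  have := Real.Gamma_pos_of_pos ha
  have hlaplace := integrable_and_integral_kappa_mul_exp ha hr
  set g : ℝ → ℝ := fun u => kappa a u * Real.exp (-(r * u))
  have hg : ∫ u in Ioi 0, g u = r ^ (-a) := by
    rw [← hlaplace.2]
    refine setIntegral_eq_integral_of_forall_compl_eq_zero fun u hu => ?_
    simp only [g, kappa_of_nonpos (notMem_Ioi.1 hu), zero_mul]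
  have hinv : (fun t => kappa s t * (t ^ (-a - s) * Real.exp (-(r / t)))) =
      (Ioi (0 : ℝ)).indicator fun t => Real.Gamma a / Real.Gamma s *
        ((|(-1 : ℝ)| * t ^ ((-1 : ℝ) - 1)) • g (t ^ (-1 : ℝ))) := by
    ext t
    by_cases ht : 0 < t
    · rw [indicator_of_mem (mem_Ioi.2 ht)]
      simp only [g, Real.rpow_neg_one, kappa_of_pos ht, kappa_of_pos (inv_pos.2 ht), smul_eq_mul]
      rw [Real.inv_rpow ht.le, ← Real.rpow_neg ht.le, div_mul_eq_mul_div, ← mul_assoc,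
        ← Real.rpow_add ht, show s - 1 + (-a - s) = (-1 - 1) + -(a - 1) by ring, Real.rpow_add ht]
      field_simp
      norm_num
    · rw [indicator_of_notMem (by simpa using ht), kappa_of_nonpos (not_lt.1 ht), zero_mul]
  have hne : (-1 : ℝ) ≠ 0 := by norm_num
  rw [hinv, integrable_indicator_iff measurableSet_Ioi, integral_indicator measurableSet_Ioi,
    integral_const_mul, integral_comp_rpow_Ioi g hne, hg]
  exact ⟨((integrableOn_Ioi_comp_rpow_iff g hne).2 hlaplace.1.integrableOn).const_mul _, rfl⟩

lemma kappa_add_kappa_neg {σ z : ℝ} (hz : z ≠ 0) :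
    kappa σ z + kappa σ (-z) = |z| ^ (σ - 1) / Real.Gamma σ := by
  rcases lt_or_gt_of_ne hz with h | h
  · rw [kappa_of_nonpos h.le, kappa_of_pos (neg_pos.2 h), zero_add, abs_of_neg h]
  · rw [kappa_of_pos h, kappa_of_nonpos (neg_nonpos.2 h.le), add_zero, abs_of_pos h]

lemma integral_rpow_abs_sub_mul {σ : ℝ} (h0 : 0 < σ) (h1 : σ ≤ 1) {f : ℝ → ℝ}
    (hf : Integrable f) (hf2 : MemLp f 2) :
    Integrable (fun z : ℝ × ℝ => |z.1 - z.2| ^ (σ - 1) * (f z.1 * f z.2)) ∧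
      ∫ z : ℝ × ℝ, |z.1 - z.2| ^ (σ - 1) * (f z.1 * f z.2) =
        2 * Real.Gamma σ * energy σ f := by
  have := Real.Gamma_pos_of_pos h0
  obtain ⟨hint, henergy⟩ := integral_kappa_add_kappa_mul h0 h1 hf hf2
  have hae : (fun z : ℝ × ℝ => Real.Gamma σ *
      ((kappa σ (z.1 - z.2) + kappa σ (z.2 - z.1)) * (f z.1 * f z.2))) =ᵐ[volume]
      fun z => |z.1 - z.2| ^ (σ - 1) * (f z.1 * f z.2) :=
    ae_fst_ne_snd.mono fun z hz => by
      dsimp only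
      rw [← neg_sub z.1 z.2, kappa_add_kappa_neg (sub_ne_zero.2 hz)]
      field_simp
  refine ⟨(hint.const_mul _).congr hae, ?_⟩
  rw [← integral_congr_ae hae, integral_const_mul, henergy]
  ring

lemma rpow_pi_mul_sq {z : ℝ} (a : ℝ) :
    (Real.pi * z ^ 2) ^ (-a) = Real.pi ^ (-a) * |z| ^ (-(2 * a)) := by
  rw [Real.mul_rpow Real.pi_pos.le (sq_nonneg z), ← sq_abs, ← Real.rpow_natCast,
    ← Real.rpow_mul (abs_nonneg z)]
  push_cast
  ring_nf

lemma energy_eq_integral_gaussian {σ : ℝ} (h0 : 0 < σ) (h1 : σ < 1) {f : ℝ → ℝ}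
    (hf : Integrable f) (hf2 : MemLp f 2) :
    Integrable (fun t => kappa ((1 - σ) / 2) t *
      ∫ z : ℝ × ℝ, Real.exp (-(Real.pi * (z.1 - z.2) ^ 2 * t)) * (f z.1 * f z.2)) ∧
    ∫ t, kappa ((1 - σ) / 2) t *
      ∫ z : ℝ × ℝ, Real.exp (-(Real.pi * (z.1 - z.2) ^ 2 * t)) * (f z.1 * f z.2) =
        Real.pi ^ (-((1 - σ) / 2)) * (2 * Real.Gamma σ) * energy σ f := by
  set s := (1 - σ) / 2 with hs
  have hs0 : 0 < s := by linarith
  obtain ⟨hint, henergy⟩ := integral_rpow_abs_sub_mul h0 h1.le hf hf2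
  have hlaplace : ∀ᵐ z : ℝ × ℝ,
      Integrable (fun t => kappa s t * Real.exp (-(Real.pi * (z.1 - z.2) ^ 2 * t))) ∧
      (∫ t, kappa s t * Real.exp (-(Real.pi * (z.1 - z.2) ^ 2 * t))) * (f z.1 * f z.2) =
        Real.pi ^ (-s) * (|z.1 - z.2| ^ (σ - 1) * (f z.1 * f z.2)) := by
    filter_upwards [ae_fst_ne_snd] with z hz
    have : z.1 - z.2 ≠ 0 := sub_ne_zero.2 hz
    obtain ⟨hi, hv⟩ := integrable_and_integral_kappa_mul_exp hs0
      (by positivity : 0 < Real.pi * (z.1 - z.2) ^ 2)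
    rw [hv, rpow_pi_mul_sq, mul_assoc, show -(2 * s) = σ - 1 by ring]
    exact ⟨hi, rfl⟩
  have hk : Measurable (Function.uncurry fun (t : ℝ) (z : ℝ × ℝ) =>
      kappa s t * Real.exp (-(Real.pi * (z.1 - z.2) ^ 2 * t))) := by fun_prop
  have hk0 : ∀ (t : ℝ) (z : ℝ × ℝ),
      0 ≤ kappa s t * Real.exp (-(Real.pi * (z.1 - z.2) ^ 2 * t)) :=
    fun t z => mul_nonneg (kappa_nonneg hs0 t) (Real.exp_pos _).le
  have hval := hlaplace.mono fun z hz => hz.2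
  have hkF := (hint.const_mul (Real.pi ^ (-s))).congr (hval.mono fun z hz => hz.symm)
  have hF : AEStronglyMeasurable fun z : ℝ × ℝ => f z.1 * f z.2 := hf.1.comp_fst.mul hf.1.comp_snd
  have hki := hlaplace.mono fun z hz => hz.1
  simp only [← integral_const_mul, ← mul_assoc (kappa s _)]
  refine ⟨(integrable_kernel_mul (μ := volume) hk hk0 hki hF hkF).integral_prod_left, ?_⟩
  rw [integral_integral_kernel_mul hk hk0 hki hF hkF, integral_congr_ae hval, integral_const_mul,
    henergy]
  ring

lemma energy_eq_integral_integral_fourier {σ : ℝ} (h0 : 0 < σ) (h1 : σ < 1) {f : ℝ → ℝ}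
    (hf : Integrable f) (hf2 : MemLp f 2) :
    Integrable (Function.uncurry fun t ξ : ℝ => kappa ((1 - σ) / 2) t *
      (t ^ (-(1 / 2) : ℝ) * Real.exp (-(Real.pi * ξ ^ 2 / t))) *
        ‖𝓕 (fun x => (f x : ℂ)) ξ‖ ^ 2) (volume.prod volume) ∧
    ∫ t, ∫ ξ : ℝ, kappa ((1 - σ) / 2) t *
      (t ^ (-(1 / 2) : ℝ) * Real.exp (-(Real.pi * ξ ^ 2 / t))) * ‖𝓕 (fun x => (f x : ℂ)) ξ‖ ^ 2 =
        Real.pi ^ (-((1 - σ) / 2)) * (2 * Real.Gamma σ) * energy σ f := by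
  obtain ⟨hint, henergy⟩ := energy_eq_integral_gaussian h0 h1 hf hf2
  set s := (1 - σ) / 2 with hs
  set k : ℝ → ℝ → ℝ := fun t ξ =>
    kappa s t * (t ^ (-(1 / 2) : ℝ) * Real.exp (-(Real.pi * ξ ^ 2 / t))) *
      ‖𝓕 (fun x => (f x : ℂ)) ξ‖ ^ 2
  have hk0 : ∀ t ξ, 0 ≤ k t ξ := fun t ξ => by
    rcases le_or_gt t 0 with ht | ht
    · simp only [k, kappa_of_nonpos ht, zero_mul, le_refl]
    · exact mul_nonneg (mul_nonneg (kappa_nonneg (by linarith) t) (by positivity)) (by positivity)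
  have hslice : ∀ t, Integrable (fun ξ => k t ξ) ∧ ∫ ξ, k t ξ = kappa s t *
      ∫ z : ℝ × ℝ, Real.exp (-(Real.pi * (z.1 - z.2) ^ 2 * t)) * (f z.1 * f z.2) := fun t => by
    rcases le_or_gt t 0 with ht | ht
    · simp only [k, kappa_of_nonpos ht, zero_mul, integral_zero, and_true]
      exact integrable_zero _ _ _
    · obtain ⟨hi, hv⟩ := integral_gaussian_sub_mul ht hf
      rw [hv]
      simp only [k, mul_assoc (kappa s t), mul_assoc (t ^ (-(1 / 2) : ℝ)), integral_const_mul,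
        and_true]
      exact (hi.const_mul _).const_mul _
  have hF := (continuous_fourier_ofReal hf).measurable
  have hmeas : Measurable (Function.uncurry k) := by fun_prop
  refine ⟨(integrable_prod_iff hmeas.aestronglyMeasurable).2 ⟨ae_of_all _ fun t => (hslice t).1,
    hint.congr (ae_of_all _ fun t => ?_)⟩, ?_⟩
  · simp only [Function.uncurry_apply_pair, Real.norm_of_nonneg (hk0 _ _), (hslice t).2]
  · rw [integral_congr_ae (ae_of_all _ fun t => (hslice t).2), henergy]

lemma exists_energy_eq_integral_fourier {σ : ℝ} (h0 : 0 < σ) (h1 : σ < 1) :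
    ∃ C : ℝ, 0 < C ∧ ∀ f : ℝ → ℝ, Integrable f → MemLp f 2 →
      Integrable (fun ξ => |ξ| ^ (-σ) * ‖𝓕 (fun x => (f x : ℂ)) ξ‖ ^ 2) ∧
      energy σ f = C * ∫ ξ, |ξ| ^ (-σ) * ‖𝓕 (fun x => (f x : ℂ)) ξ‖ ^ 2 := by
  have hs0 : 0 < (1 - σ) / 2 := by linarith
  set c₁ := Real.pi ^ (-((1 - σ) / 2)) * (2 * Real.Gamma σ)
  set c₂ := Real.Gamma (σ / 2) / Real.Gamma ((1 - σ) / 2) * Real.pi ^ (-(σ / 2))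
  have hc₁ : 0 < c₁ := by
    have := Real.Gamma_pos_of_pos h0
    positivity
  have hc₂ : 0 < c₂ := by
    have := Real.Gamma_pos_of_pos hs0
    have := Real.Gamma_pos_of_pos (half_pos h0)
    positivity
  refine ⟨c₁⁻¹ * c₂, by positivity, fun f hf hf2 => ?_⟩
  obtain ⟨hk, henergy⟩ := energy_eq_integral_integral_fourier h0 h1 hf hf2
  have hval : (fun ξ : ℝ => ∫ t, kappa ((1 - σ) / 2) t *
      (t ^ (-(1 / 2) : ℝ) * Real.exp (-(Real.pi * ξ ^ 2 / t))) * ‖𝓕 (fun x => (f x : ℂ)) ξ‖ ^ 2)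
      =ᵐ[volume] fun ξ => c₂ * (|ξ| ^ (-σ) * ‖𝓕 (fun x => (f x : ℂ)) ξ‖ ^ 2) := by
    filter_upwards [Measure.ae_ne volume 0] with ξ hξ
    rw [integral_mul_const, show (-(1 / 2) : ℝ) = -(σ / 2) - (1 - σ) / 2 by ring,
      (integrable_and_integral_kappa_mul_rpow_mul_exp_div (half_pos h0)
        (by positivity : 0 < Real.pi * ξ ^ 2)).2, rpow_pi_mul_sq, mul_div_cancel₀ σ two_ne_zero]
    ring
  refine ⟨((hk.integral_prod_right.congr hval).const_mul c₂⁻¹).congr (ae_of_all _ fun ξ =>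
    inv_mul_cancel_left₀ hc₂.ne' _), ?_⟩
  rw [mul_assoc, ← integral_const_mul, ← integral_congr_ae hval, ← integral_integral_swap hk,
    henergy, inv_mul_cancel_left₀ hc₁.ne']

instance : IsProbabilityMeasure vol01 := ⟨by simp⟩

lemma zeroExt_of_notMem {w : ℝ → ℝ} {x : ℝ} (hx : x ∉ Ioo (0 : ℝ) 1) : zeroExt w x = 0 :=
  indicator_of_notMem hx w

lemma zeroExt_congr_ae {f g : ℝ → ℝ} (h : f =ᵐ[vol01] g) : zeroExt f =ᵐ[volume] zeroExt g :=
  (ae_eq_restrict_iff_indicator_ae_eq measurableSet_Ioo).1 h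

lemma memLp_zeroExt (w : L2) : MemLp (zeroExt w) 2 :=
  (memLp_indicator_iff_restrict measurableSet_Ioo).2 (Lp.memLp w)

lemma integrable_coe (w : L2) : Integrable w vol01 := (Lp.memLp w).integrable one_le_two

lemma integrable_zeroExt (w : L2) : Integrable (zeroExt w) :=
  (integrable_indicator_iff measurableSet_Ioo).2 (integrable_coe w)

lemma integral_zeroExt_mul (w f : ℝ → ℝ) : ∫ x, zeroExt w x * f x = ∫ x, w x * f x ∂vol01 := by
  rw [← integral_indicator measurableSet_Ioo]
  simp only [zeroExt, indicator_mul_left]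

lemma inner_eq_integral (u v : L2) : inner ℝ u v = ∫ x, u x * v x ∂vol01 := by
  simp only [L2.inner_def, RCLike.inner_apply, mul_comm, conj_trivial]

lemma leftI_congr {σ : ℝ} {f g : ℝ → ℝ} (h : f =ᵐ[volume] g) : leftI σ f = leftI σ g :=
  funext fun _ => integral_congr_ae (h.mono fun s hs => by simp only [hs])

lemma rightI_congr {σ : ℝ} {f g : ℝ → ℝ} (h : f =ᵐ[volume] g) : rightI σ f = rightI σ g :=
  funext fun _ => integral_congr_ae (h.mono fun s hs => by simp only [hs])

lemma IsTest.eq_zero {ψ : ℝ → ℝ} (h : IsTest ψ) {x : ℝ} (hx : x ∉ Ioo (0 : ℝ) 1) : ψ x = 0 :=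
  image_eq_zero_of_notMem_tsupport fun hx' => hx (h.2.2 hx')

lemma IsTest.zeroExt_eq {ψ : ℝ → ℝ} (h : IsTest ψ) : zeroExt ψ = ψ :=
  indicator_eq_self.2 ((subset_tsupport ψ).trans h.2.2)

lemma IsTest.differentiable {ψ : ℝ → ℝ} (h : IsTest ψ) : Differentiable ℝ ψ :=
  h.1.differentiable (by simp)

lemma IsTest.isTest_deriv {ψ : ℝ → ℝ} (h : IsTest ψ) : IsTest (deriv ψ) :=
  ⟨h.1.deriv', h.2.1.deriv, tsupport_deriv_subset.trans h.2.2⟩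

lemma IsTest.continuous {ψ : ℝ → ℝ} (h : IsTest ψ) : Continuous ψ := h.1.continuous

lemma IsTest.integrable {ψ : ℝ → ℝ} (h : IsTest ψ) : Integrable ψ :=
  h.continuous.integrable_of_hasCompactSupport h.2.1

lemma IsTest.memLp {ψ : ℝ → ℝ} (h : IsTest ψ) : MemLp ψ 2 :=
  h.continuous.memLp_of_hasCompactSupport h.2.1

/-- The vector space of test functions on `(0,1)`. -/
def testSpace : Submodule ℝ (ℝ → ℝ) where
  carrier := {ψ | IsTest ψ}
  zero_mem' := ⟨contDiff_const, .zero, by simp [tsupport]⟩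
  add_mem' {ψ χ} hψ hχ := ⟨hψ.1.add hχ.1, hψ.2.1.add hχ.2.1,
    (tsupport_add ψ χ).trans (union_subset hψ.2.2 hχ.2.2)⟩
  smul_mem' c ψ hψ := ⟨contDiff_const.smul hψ.1, hψ.2.1.smul_left (f := fun _ => c),
    (tsupport_smul_subset_right (fun _ => c) ψ).trans hψ.2.2⟩

/-- The linear map into `L^p` induced by a linear map whose values are `p`-integrable functions. -/
def lpMap {V α E : Type*} [AddCommGroup V] [Module ℝ V] [MeasurableSpace α] {μ : Measure α}
    [NormedAddCommGroup E] [NormedSpace ℝ E] {p : ℝ≥0∞} (T : V →ₗ[ℝ] α → E)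
    (hT : ∀ v, MemLp (T v) p μ) : V →ₗ[ℝ] Lp E p μ where
  toFun v := (hT v).toLp
  map_add' v w := by simp only [map_add, MemLp.toLp_add (hT v) (hT w)]
  map_smul' c v := by simp only [map_smul, MemLp.toLp_const_smul c (hT v), RingHom.id_apply]

lemma coeFn_lpMap {V α E : Type*} [AddCommGroup V] [Module ℝ V] [MeasurableSpace α]
    {μ : Measure α} [NormedAddCommGroup E] [NormedSpace ℝ E] {p : ℝ≥0∞} {T : V →ₗ[ℝ] α → E}
    (hT : ∀ v, MemLp (T v) p μ) (v : V) : lpMap T hT v =ᵐ[μ] T v :=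
  (hT v).coeFn_toLp

/-- The class in `L²(0,1)` of a test function. -/
def testClass : testSpace →ₗ[ℝ] L2 :=
  lpMap testSpace.subtype fun ψ => ψ.2.memLp.restrict _

lemma coeFn_testClass (ψ : testSpace) : testClass ψ =ᵐ[vol01] ψ := coeFn_lpMap _ ψ

/-- Differentiation of test functions. -/
def testDeriv : testSpace →ₗ[ℝ] testSpace where
  toFun ψ := ⟨deriv ψ, ψ.2.isTest_deriv⟩
  map_add' ψ χ := Subtype.ext <| funext fun x =>
    deriv_add (ψ.2.differentiable x) (χ.2.differentiable x)
  map_smul' c ψ := Subtype.ext <| funext fun x => deriv_const_smul c (ψ.2.differentiable x)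

lemma locallyIntegrable_kappa {σ : ℝ} (h0 : 0 < σ) (h1 : σ ≤ 1) :
    LocallyIntegrable (kappa σ) := by
  obtain ⟨k₁, k₂, hk₁, hk₂, ⟨C, hC⟩, hk⟩ := exists_kappa_eq_add h0 h1
  rw [hk]
  exact hk₁.locallyIntegrable.add
    ((locallyIntegrable_const C).mono hk₂.aestronglyMeasurable
      (ae_of_all _ fun z => (hC z).trans (le_abs_self C)))

lemma integrable_kappa_sub_mul {σ : ℝ} (h0 : 0 < σ) (h1 : σ ≤ 1) {f : ℝ → ℝ} (hf : Continuous f)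
    (hc : HasCompactSupport f) (x : ℝ) : Integrable fun s => kappa σ (x - s) * f s := by
  simpa using (hc.convolutionExists_right (ContinuousLinearMap.mul ℝ ℝ) (μ := volume)
    (locallyIntegrable_kappa h0 h1) hf x).integrable_swap

lemma integrable_kappa_sub_mul' {σ : ℝ} (h0 : 0 < σ) (h1 : σ ≤ 1) {f : ℝ → ℝ} (hf : Continuous f)
    (hc : HasCompactSupport f) (x : ℝ) : Integrable fun s => kappa σ (s - x) * f s := by
  have := (integrable_kappa_sub_mul h0 h1 (hf.comp continuous_neg)
    (hc.comp_homeomorph (Homeomorph.neg ℝ)) (-x)).comp_neg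
  simpa [neg_add_eq_sub] using this

section FractionalDerivative

variable {σ : ℝ} (h0 : 0 < σ) (h1 : σ ≤ 1)

/-- The left fractional derivative of order `1 - σ` of test functions. -/
def leftD : testSpace →ₗ[ℝ] ℝ → ℝ where
  toFun ψ := leftI σ (testDeriv ψ)
  map_add' ψ χ := funext fun x => by
    simp only [leftI, map_add, Submodule.coe_add, Pi.add_apply, mul_add]
    exact integral_add
      (integrable_kappa_sub_mul h0 h1 (testDeriv ψ).2.continuous (testDeriv ψ).2.2.1 x)
      (integrable_kappa_sub_mul h0 h1 (testDeriv χ).2.continuous (testDeriv χ).2.2.1 x)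
  map_smul' c ψ := funext fun x => by
    simp only [leftI, map_smul, Submodule.coe_smul, Pi.smul_apply, smul_eq_mul, mul_left_comm _ c,
      integral_const_mul, RingHom.id_apply]

/-- The negative of the right fractional derivative of order `1 - σ` of test functions. -/
def rightD : testSpace →ₗ[ℝ] ℝ → ℝ where
  toFun ψ := rightI σ (testDeriv ψ)
  map_add' ψ χ := funext fun x => by
    simp only [rightI, map_add, Submodule.coe_add, Pi.add_apply, mul_add]
    exact integral_add
      (integrable_kappa_sub_mul' h0 h1 (testDeriv ψ).2.continuous (testDeriv ψ).2.2.1 x)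
      (integrable_kappa_sub_mul' h0 h1 (testDeriv χ).2.continuous (testDeriv χ).2.2.1 x)
  map_smul' c ψ := funext fun x => by
    simp only [rightI, map_smul, Submodule.coe_smul, Pi.smul_apply, smul_eq_mul,
      mul_left_comm _ c, integral_const_mul, RingHom.id_apply]

end FractionalDerivative

lemma kappa_one_sub_mul (x : ℝ) (f : ℝ → ℝ) :
    (fun s => kappa 1 (x - s) * f s) = (Iio x).indicator f := by
  ext s
  by_cases hs : s < x <;> simp [kappa_one, hs]

lemma kappa_one_sub_mul' (x : ℝ) (f : ℝ → ℝ) :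
    (fun s => kappa 1 (s - x) * f s) = (Ioi x).indicator f := by
  ext s
  by_cases hs : x < s <;> simp [kappa_one, hs]

lemma leftI_one (f : ℝ → ℝ) (x : ℝ) : leftI 1 f x = ∫ s in Iio x, f s := by
  rw [leftI, kappa_one_sub_mul, integral_indicator measurableSet_Iio]

lemma rightI_one (f : ℝ → ℝ) (x : ℝ) : rightI 1 f x = ∫ s in Ioi x, f s := by
  rw [rightI, kappa_one_sub_mul', integral_indicator measurableSet_Ioi]

lemma leftI_one_sub_leftI {β : ℝ} (h0 : 0 < β) (h1 : β < 1) {f : ℝ → ℝ} (hf : Integrable f)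
    (x : ℝ) : leftI (1 - β) (leftI β f) x = leftI 1 f x := by
  rw [leftI_leftI (sub_pos.2 h1) h0 hf.1, sub_add_cancel]
  rw [sub_add_cancel, kappa_one_sub_mul]
  exact hf.indicator measurableSet_Iio

lemma rightI_one_sub_rightI {β : ℝ} (h0 : 0 < β) (h1 : β < 1) {f : ℝ → ℝ} (hf : Integrable f)
    (x : ℝ) : rightI (1 - β) (rightI β f) x = rightI 1 f x := by
  simp only [rightI_eq_leftI_comp_neg, neg_neg]
  exact leftI_one_sub_leftI h0 h1 hf.comp_neg (-x)

lemma leftI_one_testDeriv (ψ : testSpace) (x : ℝ) : leftI 1 (testDeriv ψ) x = ψ.1 x := by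
  rw [leftI_one, ← integral_Iic_eq_integral_Iio]
  exact HasCompactSupport.integral_Iic_deriv_eq (ψ.2.1.of_le (by simp)) ψ.2.2.1 x

lemma rightI_one_testDeriv (ψ : testSpace) (x : ℝ) : rightI 1 (testDeriv ψ) x = -ψ.1 x := by
  rw [rightI_one]
  exact HasCompactSupport.integral_Ioi_deriv_eq (ψ.2.1.of_le (by simp)) ψ.2.2.1 x

lemma leftI_zeroExt_of_le_one {σ x : ℝ} {f : ℝ → ℝ} (hf : ∀ s ≤ 0, f s = 0) (hx : x ≤ 1) :
    leftI σ (zeroExt f) x = leftI σ f x := by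
  refine integral_congr_ae (ae_of_all _ fun s => ?_)
  rcases le_or_gt s 0 with h0 | h0
  · simp [zeroExt, hf s h0]
  rcases le_or_gt x s with h | h
  · simp [kappa_of_nonpos (sub_nonpos.2 h)]
  · simp [zeroExt, h0, h.trans_le hx]

lemma rightI_zeroExt_of_nonneg {σ x : ℝ} {f : ℝ → ℝ} (hf : ∀ s, 1 ≤ s → f s = 0) (hx : 0 ≤ x) :
    rightI σ (zeroExt f) x = rightI σ f x := by
  refine integral_congr_ae (ae_of_all _ fun s => ?_)
  rcases le_or_gt 1 s with h0 | h0
  · simp [zeroExt, hf s h0]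
  rcases le_or_gt s x with h | h
  · simp [kappa_of_nonpos (sub_nonpos.2 h)]
  · simp [zeroExt, h0, hx.trans_lt h]

lemma leftI_of_nonpos {σ x : ℝ} {f : ℝ → ℝ} (hf : ∀ s ≤ 0, f s = 0) (hx : x ≤ 0) :
    leftI σ f x = 0 := by
  refine integral_eq_zero_of_ae (ae_of_all _ fun s => ?_)
  rcases le_or_gt x s with h | h
  · simp [kappa_of_nonpos (sub_nonpos.2 h)]
  · simp [hf s (h.le.trans hx)]

lemma rightI_of_one_le {σ x : ℝ} {f : ℝ → ℝ} (hf : ∀ s, 1 ≤ s → f s = 0) (hx : 1 ≤ x) :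
    rightI σ f x = 0 := by
  refine integral_eq_zero_of_ae (ae_of_all _ fun s => ?_)
  rcases le_or_gt s x with h | h
  · simp [kappa_of_nonpos (sub_nonpos.2 h)]
  · simp [hf s (hx.trans h.le)]

lemma kappa_sq {σ : ℝ} (hσ : 1 / 2 < σ) (z : ℝ) :
    kappa σ z ^ 2 = Real.Gamma (2 * σ - 1) / Real.Gamma σ ^ 2 * kappa (2 * σ - 1) z := by
  rcases le_or_gt z 0 with hz | hz
  · simp [kappa_of_nonpos hz]
  · have := (Real.Gamma_pos_of_pos (by linarith : 0 < 2 * σ - 1)).ne'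
    rw [kappa_of_pos hz, kappa_of_pos hz, div_pow, ← Real.rpow_natCast, ← Real.rpow_mul hz.le,
      show (σ - 1) * (2 : ℕ) = 2 * σ - 1 - 1 by push_cast; ring]
    field_simp

section SquareIntegrableKernel

variable {σ : ℝ} (hσ : 1 / 2 < σ) (h1 : σ ≤ 1)

include hσ h1

lemma integrableOn_kappa_sq (a b : ℝ) : IntegrableOn (fun z => kappa σ z ^ 2) (Ioo a b) := by
  simp only [kappa_sq hσ]
  exact (((locallyIntegrable_kappa (by linarith) (by linarith)).integrableOn_isCompact
    isCompact_Icc).mono_set Ioo_subset_Icc_self).const_mul _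

lemma memLp_kappa_const_sub (x : ℝ) : MemLp (fun s => kappa σ (x - s)) 2 vol01 := by
  refine (memLp_two_iff_integrable_sq
    ((measurable_kappa σ).comp (by fun_prop)).aestronglyMeasurable).2 ?_
  simpa [IntegrableOn, Function.comp_def] using
    ((volume.measurePreserving_sub_left x).integrableOn_comp_preimage
      (MeasurableEquiv.subLeft x).measurableEmbedding).2 (integrableOn_kappa_sq hσ h1 (x - 1) x)

lemma memLp_kappa_sub_const (x : ℝ) : MemLp (fun s => kappa σ (s - x)) 2 vol01 := by
  refine (memLp_two_iff_integrable_sq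
    ((measurable_kappa σ).comp (by fun_prop)).aestronglyMeasurable).2 ?_
  simpa [IntegrableOn, Function.comp_def] using
    ((measurePreserving_sub_right volume x).integrableOn_comp_preimage
    (MeasurableEquiv.subRight x).measurableEmbedding).2 (integrableOn_kappa_sq hσ h1 (-x) (1 - x))

lemma leftI_zeroExt_eq_inner (a : L2) (x : ℝ) :
    leftI σ (zeroExt a) x = inner ℝ ((memLp_kappa_const_sub hσ h1 x).toLp _) a := by
  simp only [leftI, mul_comm (kappa σ _), integral_zeroExt_mul, inner_eq_integral]
  refine integral_congr_ae ((memLp_kappa_const_sub hσ h1 x).coeFn_toLp.mono fun s hs => ?_)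
  simp only [hs, mul_comm]

lemma rightI_zeroExt_eq_inner (a : L2) (x : ℝ) :
    rightI σ (zeroExt a) x = inner ℝ ((memLp_kappa_sub_const hσ h1 x).toLp _) a := by
  simp only [rightI, mul_comm (kappa σ _), integral_zeroExt_mul, inner_eq_integral]
  refine integral_congr_ae ((memLp_kappa_sub_const hσ h1 x).coeFn_toLp.mono fun s hs => ?_)
  simp only [hs, mul_comm]

lemma continuous_leftI_zeroExt (x : ℝ) : Continuous fun a : L2 => leftI σ (zeroExt a) x := by
  simp only [leftI_zeroExt_eq_inner hσ h1]
  fun_prop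

lemma continuous_rightI_zeroExt (x : ℝ) : Continuous fun a : L2 => rightI σ (zeroExt a) x := by
  simp only [rightI_zeroExt_eq_inner hσ h1]
  fun_prop

lemma exists_abs_leftI_zeroExt_le :
    ∃ B : ℝ, ∀ (a : L2) (x : ℝ), x ∈ Icc (0 : ℝ) 1 → |leftI σ (zeroExt a) x| ≤ B * ‖a‖ := by
  refine ⟨√(∫ z in Ioo (-1 : ℝ) 1, kappa σ z ^ 2), fun a x hx => ?_⟩
  rw [leftI_zeroExt_eq_inner hσ h1]
  refine (abs_real_inner_le_norm _ _).trans (mul_le_mul_of_nonneg_right ?_ (norm_nonneg a))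
  refine Real.le_sqrt_of_sq_le ?_
  have hae := (memLp_kappa_const_sub hσ h1 x).coeFn_toLp
  calc ‖(memLp_kappa_const_sub hσ h1 x).toLp‖ ^ 2
    _ = ∫ s in Ioo 0 1, kappa σ (x - s) ^ 2 := by
      rw [← real_inner_self_eq_norm_sq, inner_eq_integral]
      exact integral_congr_ae (hae.mono fun s hs => by simp only [hs, sq])
    _ = ∫ z in Ioo (x - 1) x, kappa σ z ^ 2 := by
      simpa using (volume.measurePreserving_sub_left x).setIntegral_preimage_emb
        (MeasurableEquiv.subLeft x).measurableEmbedding (fun z => kappa σ z ^ 2) (Ioo (x - 1) x)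
    _ ≤ ∫ z in Ioo (-1) 1, kappa σ z ^ 2 :=
      setIntegral_mono_set (integrableOn_kappa_sq hσ h1 _ _) (ae_of_all _ fun z => sq_nonneg _)
        (Ioo_subset_Ioo (by linarith [hx.1]) hx.2).eventuallyLE

end SquareIntegrableKernel

lemma isClosed_setOf_ae_eq {X α E : Type*} [TopologicalSpace X] [FirstCountableTopology X]
    [MeasurableSpace α] {μ : Measure α} [NormedAddCommGroup E] {p : ℝ≥0∞} [Fact (1 ≤ p)]
    {Φ : X → α → E} (hΦ : ∀ x, Continuous fun a => Φ a x) :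
    IsClosed {q : Lp E p μ × X | q.1 =ᵐ[μ] Φ q.2} := by
  refine isSeqClosed_iff_isClosed.1 fun q r hq hr => ?_
  rw [nhds_prod_eq, Filter.tendsto_prod_iff'] at hr
  obtain ⟨ns, hns, hae⟩ := (tendstoInMeasure_of_tendsto_Lp hr.1).exists_seq_tendsto_ae
  filter_upwards [hae, ae_all_iff.2 hq] with x hx hqx
  simp only [hqx] at hx
  exact tendsto_nhds_unique hx
    (((hΦ x).tendsto _).comp (hr.2.comp hns.tendsto_atTop))

lemma energy_nonneg {σ : ℝ} (h0 : 0 < σ) (h1 : σ < 1) {f : ℝ → ℝ} (hf : Integrable f)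
    (hf2 : MemLp f 2) : 0 ≤ energy σ f := by
  obtain ⟨C, hC, h⟩ := exists_energy_eq_integral_fourier h0 h1
  rw [(h f hf hf2).2]
  exact mul_nonneg hC.le (integral_nonneg fun ξ => by positivity)

lemma norm_sq_eq_integral {α E : Type*} [MeasurableSpace α] {μ : Measure α}
    [NormedAddCommGroup E] [InnerProductSpace ℝ E] (u : Lp E 2 μ) :
    ‖u‖ ^ 2 = ∫ x, ‖u x‖ ^ 2 ∂μ := by
  rw [← real_inner_self_eq_norm_sq, L2.inner_def]
  simp only [real_inner_self_eq_norm_sq]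

section FractionalGraph

variable {β : ℝ} (h0 : 0 < β) (h1 : β < 1 / 2)

lemma memLp_leftD (ψ : testSpace) : MemLp (leftD h0 (by linarith) ψ) 2 vol01 :=
  have ⟨_, h⟩ := exists_integral_leftI_sq h0 h1
  (h _ (testDeriv ψ).2.integrable (testDeriv ψ).2.memLp).1.restrict _

lemma memLp_rightD (ψ : testSpace) : MemLp (rightD h0 (by linarith) ψ) 2 vol01 :=
  have ⟨_, h⟩ := exists_integral_rightI_sq h0 h1
  (h _ (testDeriv ψ).2.integrable (testDeriv ψ).2.memLp).1.restrict _

/-- The classes in `L²(0,1)` of the left fractional derivative and of the negative of the right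
fractional derivative, both of order `1 - β`, of a test function. -/
def fracPair : testSpace →ₗ[ℝ] L2 × L2 :=
  (lpMap _ (memLp_leftD h0 h1)).prod (lpMap _ (memLp_rightD h0 h1))

lemma coeFn_fracPair_fst (ψ : testSpace) :
    (fracPair h0 h1 ψ).1 =ᵐ[vol01] leftI β (testDeriv ψ) :=
  coeFn_lpMap (memLp_leftD h0 h1) ψ

lemma coeFn_fracPair_snd (ψ : testSpace) :
    (fracPair h0 h1 ψ).2 =ᵐ[vol01] rightI β (testDeriv ψ) :=
  coeFn_lpMap (memLp_rightD h0 h1) ψ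

/-- The closure in `L²(0,1)³` of the graph of `fracPair`: the graph of the closed operator which
takes `φ ∈ H₀^{1-β}(0,1)` to its left and (negated) right fractional derivatives of order
`1 - β`. -/
def fracGraph : Submodule ℝ (L2 × L2 × L2) :=
  (LinearMap.range (testClass.prod (fracPair h0 h1))).topologicalClosure

variable {h0 h1}

lemma fracGraph_subset_of_isClosed {S : Set (L2 × L2 × L2)} (hS : IsClosed S)
    (h : ∀ ψ, (testClass ψ, fracPair h0 h1 ψ) ∈ S) : (fracGraph h0 h1 : Set _) ⊆ S :=
  closure_minimal (range_subset_iff.2 h) hS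

lemma testDeriv_eq_zero_of_nonpos (ψ : testSpace) (s : ℝ) (hs : s ≤ 0) :
    (testDeriv ψ).1 s = 0 :=
  (testDeriv ψ).2.eq_zero fun h => hs.not_gt h.1

lemma testDeriv_eq_zero_of_one_le (ψ : testSpace) (s : ℝ) (hs : 1 ≤ s) :
    (testDeriv ψ).1 s = 0 :=
  (testDeriv ψ).2.eq_zero fun h => hs.not_gt h.2

lemma leftI_fracPair (ψ : testSpace) {x : ℝ} (hx : x ≤ 1) :
    leftI (1 - β) (zeroExt (fracPair h0 h1 ψ).1) x = ψ.1 x := by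
  rw [leftI_congr (zeroExt_congr_ae (coeFn_fracPair_fst h0 h1 ψ)), leftI_zeroExt_of_le_one
    (fun s => leftI_of_nonpos (testDeriv_eq_zero_of_nonpos ψ)) hx,
    leftI_one_sub_leftI h0 (by linarith) (testDeriv ψ).2.integrable, leftI_one_testDeriv]

lemma rightI_fracPair (ψ : testSpace) {x : ℝ} (hx : 0 ≤ x) :
    rightI (1 - β) (zeroExt (fracPair h0 h1 ψ).2) x = -ψ.1 x := by
  rw [rightI_congr (zeroExt_congr_ae (coeFn_fracPair_snd h0 h1 ψ)), rightI_zeroExt_of_nonneg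
    (fun s => rightI_of_one_le (testDeriv_eq_zero_of_one_le ψ)) hx,
    rightI_one_sub_rightI h0 (by linarith) (testDeriv ψ).2.integrable, rightI_one_testDeriv]

lemma inner_fracPair (ψ : testSpace) :
    inner ℝ (fracPair h0 h1 ψ).1 (fracPair h0 h1 ψ).2 = energy (2 * β) (testDeriv ψ) := by
  have hψ := (testDeriv ψ).2
  have hout : ∀ x ∉ Ioo (0 : ℝ) 1, rightI β (testDeriv ψ) x * leftI β (testDeriv ψ) x = 0 := by
    intro x hx
    rcases not_and_or.1 hx with hx | hx
    · rw [leftI_of_nonpos (testDeriv_eq_zero_of_nonpos ψ) (not_lt.1 hx), mul_zero]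
    · rw [rightI_of_one_le (testDeriv_eq_zero_of_one_le ψ) (not_lt.1 hx), zero_mul]
  rw [inner_eq_integral, ← (integral_rightI_mul_leftI h0 h1 hψ.integrable hψ.memLp).2,
    ← setIntegral_eq_integral_of_forall_compl_eq_zero hout]
  refine integral_congr_ae ?_
  filter_upwards [coeFn_fracPair_fst h0 h1 ψ, coeFn_fracPair_snd h0 h1 ψ] with x hl hr
  rw [hl, hr, mul_comm]

lemma exists_norm_sq_fracPair_le :
    ∃ c : ℝ, 1 ≤ c ∧ ∀ ψ, ‖(fracPair h0 h1 ψ).1‖ ^ 2 ≤ c * energy (2 * β) (testDeriv ψ) ∧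
      ‖(fracPair h0 h1 ψ).2‖ ^ 2 ≤ c * energy (2 * β) (testDeriv ψ) := by
  obtain ⟨c₁, hl⟩ := exists_integral_leftI_sq h0 h1
  obtain ⟨c₂, hr⟩ := exists_integral_rightI_sq h0 h1
  refine ⟨max 1 (max c₁ c₂), le_max_left .., fun ψ => ?_⟩
  have hψ := (testDeriv ψ).2
  have hE := energy_nonneg (σ := 2 * β) (by linarith) (by linarith) hψ.integrable hψ.memLp
  obtain ⟨il, el⟩ := hl _ hψ.integrable hψ.memLp
  obtain ⟨ir, er⟩ := hr _ hψ.integrable hψ.memLp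
  constructor
  · calc ‖(fracPair h0 h1 ψ).1‖ ^ 2
      _ = ∫ x, leftI β (testDeriv ψ) x ^ 2 ∂vol01 := by
        simp only [norm_sq_eq_integral, Real.norm_eq_abs, sq_abs]
        exact integral_congr_ae ((coeFn_fracPair_fst h0 h1 ψ).mono fun x hx => by simp only [hx])
      _ ≤ c₁ * energy (2 * β) (testDeriv ψ) :=
        el ▸ setIntegral_le_integral il.integrable_sq (ae_of_all _ fun _ => sq_nonneg _)
      _ ≤ _ := by gcongr; simp
  · calc ‖(fracPair h0 h1 ψ).2‖ ^ 2
      _ = ∫ x, rightI β (testDeriv ψ) x ^ 2 ∂vol01 := by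
        simp only [norm_sq_eq_integral, Real.norm_eq_abs, sq_abs]
        exact integral_congr_ae ((coeFn_fracPair_snd h0 h1 ψ).mono fun x hx => by simp only [hx])
      _ ≤ c₂ * energy (2 * β) (testDeriv ψ) :=
        er ▸ setIntegral_le_integral ir.integrable_sq (ae_of_all _ fun _ => sq_nonneg _)
      _ ≤ _ := by gcongr; simp

lemma exists_norm_sq_le_inner_of_mem_fracGraph :
    ∃ c : ℝ, 1 ≤ c ∧ ∀ p ∈ fracGraph h0 h1,
      ‖p.2.1‖ ^ 2 ≤ c * inner ℝ p.2.1 p.2.2 ∧ ‖p.2.2‖ ^ 2 ≤ c * inner ℝ p.2.1 p.2.2 := by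
  obtain ⟨c, hc, h⟩ := exists_norm_sq_fracPair_le (h0 := h0) (h1 := h1)
  refine ⟨c, hc, fun p hp => fracGraph_subset_of_isClosed (S := {p | ‖p.2.1‖ ^ 2 ≤
    c * inner ℝ p.2.1 p.2.2 ∧ ‖p.2.2‖ ^ 2 ≤ c * inner ℝ p.2.1 p.2.2}) ?_ (fun ψ => ?_) hp⟩
  · have hinner : Continuous fun p : L2 × L2 × L2 => c * inner ℝ p.2.1 p.2.2 := by fun_prop
    exact (isClosed_le (f := fun p : L2 × L2 × L2 => ‖p.2.1‖ ^ 2) (by fun_prop) hinner).inter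
      (isClosed_le (f := fun p : L2 × L2 × L2 => ‖p.2.2‖ ^ 2) (by fun_prop) hinner)
  · simpa only [mem_ofPred_eq, inner_fracPair] using h ψ

lemma ae_eq_leftI_of_mem_fracGraph {p : L2 × L2 × L2} (hp : p ∈ fracGraph h0 h1) :
    p.1 =ᵐ[vol01] leftI (1 - β) (zeroExt p.2.1) := by
  refine fracGraph_subset_of_isClosed (S := {p | p.1 =ᵐ[vol01] leftI (1 - β) (zeroExt p.2.1)})
    (isClosed_setOf_ae_eq fun x => (continuous_leftI_zeroExt (by linarith) (by linarith) x).comp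
      continuous_fst) (fun ψ => ?_) hp
  filter_upwards [coeFn_testClass ψ, ae_restrict_mem measurableSet_Ioo] with x hx hxI
  rw [hx, leftI_fracPair ψ hxI.2.le]

lemma ae_eq_neg_rightI_of_mem_fracGraph {p : L2 × L2 × L2} (hp : p ∈ fracGraph h0 h1) :
    p.1 =ᵐ[vol01] fun x => -rightI (1 - β) (zeroExt p.2.2) x := by
  refine fracGraph_subset_of_isClosed
    (S := {p | p.1 =ᵐ[vol01] fun x => -rightI (1 - β) (zeroExt p.2.2) x})
    (isClosed_setOf_ae_eq (Φ := fun (q : L2 × L2) x => -rightI (1 - β) (zeroExt q.2) x) fun x =>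
      ((continuous_rightI_zeroExt (by linarith) (by linarith) x).comp continuous_snd).neg)
    (fun ψ => ?_) hp
  filter_upwards [coeFn_testClass ψ, ae_restrict_mem measurableSet_Ioo] with x hx hxI
  rw [hx, rightI_fracPair ψ hxI.1.le, neg_neg]

lemma leftI_one_eq_zero_of_mem_fracGraph {p : L2 × L2 × L2} (hp : p ∈ fracGraph h0 h1) :
    leftI (1 - β) (zeroExt p.2.1) 1 = 0 := by
  refine fracGraph_subset_of_isClosed (S := {p | leftI (1 - β) (zeroExt p.2.1) 1 = 0})
    (isClosed_eq ((continuous_leftI_zeroExt (by linarith) (by linarith) 1).comp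
      (continuous_fst.comp continuous_snd)) continuous_const) (fun ψ => ?_) hp
  exact (leftI_fracPair ψ le_rfl).trans (ψ.2.eq_zero fun h => h.2.false)

end FractionalGraph

/-- The function `y ↦ |y|^μ (𝓕 f)(y)`, whose `L²` norm is the homogeneous Sobolev norm of `f` of
order `μ`. -/
def weightedFourier (μ : ℝ) (f : ℝ → ℝ) (y : ℝ) : ℂ :=
  ((|y| ^ μ : ℝ) : ℂ) * 𝓕 (fun x => (f x : ℂ)) y

lemma weightedFourier_add {μ : ℝ} {f g : ℝ → ℝ} (hf : Integrable f) (hg : Integrable g) :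
    weightedFourier μ (f + g) = weightedFourier μ f + weightedFourier μ g := by
  ext y
  have h : 𝓕 (fun x => ((f + g) x : ℂ)) = 𝓕 (fun x => (f x : ℂ)) + 𝓕 fun x => (g x : ℂ) := by
    simp only [Pi.add_apply, Complex.ofReal_add]
    exact VectorFourier.fourierIntegral_add Real.continuous_fourierChar continuous_inner
      hf.ofReal hg.ofReal
  rw [weightedFourier, h, Pi.add_apply, mul_add]
  rfl

lemma weightedFourier_smul {μ : ℝ} (c : ℝ) (f : ℝ → ℝ) :
    weightedFourier μ (c • f) = c • weightedFourier μ f := by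
  ext y
  have h : 𝓕 (fun x => ((c • f) x : ℂ)) y = c * 𝓕 (fun x => (f x : ℂ)) y := by
    simp only [Pi.smul_apply, smul_eq_mul, Complex.ofReal_mul,
      Real.fourier_real_eq_integral_exp_smul, mul_left_comm _ (c : ℂ), integral_const_mul]
  rw [weightedFourier, h, mul_left_comm, Pi.smul_apply, Complex.real_smul, weightedFourier]

lemma weightedFourier_sub {μ : ℝ} {f g : ℝ → ℝ} (hf : Integrable f) (hg : Integrable g) :
    weightedFourier μ (f - g) = weightedFourier μ f - weightedFourier μ g := by
  rw [eq_sub_iff_add_eq, ← weightedFourier_add (hf.sub hg) hg, sub_add_cancel]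

lemma weightedFourier_congr {μ : ℝ} {f g : ℝ → ℝ} (h : f =ᵐ[volume] g) :
    weightedFourier μ f = weightedFourier μ g := by
  ext y
  simp only [weightedFourier, Real.fourier_real_eq_integral_exp_smul]
  congr 1
  exact integral_congr_ae (h.mono fun x hx => by simp only [hx])

lemma aestronglyMeasurable_weightedFourier {μ : ℝ} {f : ℝ → ℝ} (hf : Integrable f) :
    AEStronglyMeasurable (weightedFourier μ f) :=
  (by fun_prop : Measurable fun y : ℝ => ((|y| ^ μ : ℝ) : ℂ)).aestronglyMeasurable.mul
    (continuous_fourier_ofReal hf).aestronglyMeasurable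

lemma integral_norm_zeroExt_le (φ : L2) : ∫ x, ‖zeroExt φ x‖ ≤ ‖φ‖ := by
  have h : ∫ x, ‖zeroExt φ x‖ = ∫ x, ‖φ x‖ ∂vol01 := by
    simp only [zeroExt, norm_indicator_eq_indicator_norm]
    exact integral_indicator measurableSet_Ioo
  rw [h, integral_norm_eq_lintegral_enorm (Lp.memLp φ).1, ← eLpNorm_one_eq_lintegral_enorm,
    Lp.norm_def]
  exact ENNReal.toReal_mono (Lp.memLp φ).2.ne
    (eLpNorm_le_eLpNorm_of_exponent_le one_le_two (Lp.memLp φ).1)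

lemma zeroExt_sub_ae (φ χ : L2) :
    zeroExt φ - zeroExt χ =ᵐ[volume] zeroExt (φ - χ : L2) := by
  refine Filter.EventuallyEq.trans (ae_of_all _ fun x => ?_)
    (zeroExt_congr_ae (Lp.coeFn_sub φ χ)).symm
  exact congrFun (indicator_sub _ φ χ).symm x

lemma continuous_weightedFourier_zeroExt (μ y : ℝ) :
    Continuous fun φ : L2 => weightedFourier μ (zeroExt φ) y := by
  refine (LipschitzWith.of_dist_le_mul (K := (|y| ^ μ).toNNReal) fun φ χ => ?_).continuous
  have hsub := congrFun (weightedFourier_sub (μ := μ) (integrable_zeroExt φ)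
    (integrable_zeroExt χ)) y
  rw [dist_eq_norm, dist_eq_norm, ← Pi.sub_apply, ← hsub,
    weightedFourier_congr (zeroExt_sub_ae φ χ), weightedFourier, norm_mul, Complex.norm_real,
    Real.coe_toNNReal _ (by positivity), Real.norm_of_nonneg (by positivity)]
  gcongr
  exact (norm_fourier_ofReal_le _ y).trans (integral_norm_zeroExt_le _)

/-- `weightedFourier` on test functions. -/
def testFourier (μ : ℝ) : testSpace →ₗ[ℝ] ℝ → ℂ where
  toFun ψ := weightedFourier μ ψ
  map_add' ψ χ := weightedFourier_add ψ.2.integrable χ.2.integrable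
  map_smul' c ψ := weightedFourier_smul c ψ

lemma fourier_testDeriv (ψ : testSpace) (y : ℝ) :
    𝓕 (fun x => ((testDeriv ψ).1 x : ℂ)) y =
      2 * Real.pi * Complex.I * y * 𝓕 (fun x => (ψ.1 x : ℂ)) y := by
  have hd : (fun x => ((testDeriv ψ).1 x : ℂ)) = deriv fun x => (ψ.1 x : ℂ) :=
    funext fun x => ((ψ.2.differentiable x).hasDerivAt.ofReal_comp).deriv.symm
  rw [hd, Real.fourier_deriv ψ.2.integrable.ofReal]
  · exact smul_eq_mul ..
  · exact fun x => (ψ.2.differentiable x).hasDerivAt.ofReal_comp.differentiableAt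
  · exact hd ▸ (testDeriv ψ).2.integrable.ofReal

lemma norm_sq_weightedFourier {μ : ℝ} (ψ : testSpace) {y : ℝ} (hy : y ≠ 0) :
    ‖weightedFourier μ ψ y‖ ^ 2 = ((2 * Real.pi) ^ 2)⁻¹ *
      (|y| ^ (2 * μ - 2) * ‖𝓕 (fun x => ((testDeriv ψ).1 x : ℂ)) y‖ ^ 2) := by
  have hy' : 0 < |y| := abs_pos.2 hy
  rw [fourier_testDeriv, weightedFourier, Real.rpow_sub hy', mul_comm 2 μ,
    Real.rpow_mul hy'.le, Real.rpow_two, Real.rpow_two]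
  simp only [norm_mul, Complex.norm_real, Complex.norm_I, Complex.norm_ofNat, Real.norm_eq_abs,
    abs_of_pos Real.pi_pos, mul_one, abs_of_pos (Real.rpow_pos_of_pos hy' μ)]
  field_simp

lemma memLp_testFourier_of_integrable {μ : ℝ} {ψ : testSpace} (h : Integrable fun y : ℝ =>
      |y| ^ (2 * μ - 2) * ‖𝓕 (fun x => ((testDeriv ψ).1 x : ℂ)) y‖ ^ 2) :
    MemLp (testFourier μ ψ) 2 :=
  (memLp_two_iff_integrable_sq_norm (aestronglyMeasurable_weightedFourier ψ.2.integrable)).2 <|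
    (h.const_mul ((2 * Real.pi) ^ 2)⁻¹).congr <| (Measure.ae_ne volume (0 : ℝ)).mono
      fun _ hy => (norm_sq_weightedFourier ψ hy).symm

lemma integral_norm_sq_testFourier (μ : ℝ) (ψ : testSpace) :
    ∫ y, ‖testFourier μ ψ y‖ ^ 2 = ((2 * Real.pi) ^ 2)⁻¹ *
      ∫ y, |y| ^ (2 * μ - 2) * ‖𝓕 (fun x => ((testDeriv ψ).1 x : ℂ)) y‖ ^ 2 := by
  rw [← integral_const_mul]
  exact integral_congr_ae ((Measure.ae_ne volume (0 : ℝ)).mono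
    fun y hy => norm_sq_weightedFourier ψ hy)

lemma IsTest.plancherel {ψ : ℝ → ℝ} (h : IsTest ψ) :
    Integrable (fun y => ‖𝓕 (fun x => (ψ x : ℂ)) y‖ ^ 2) ∧
      ∫ y, ‖𝓕 (fun x => (ψ x : ℂ)) y‖ ^ 2 = ∫ x, ψ x ^ 2 := by
  have hc : HasCompactSupport fun x => (ψ x : ℂ) := h.2.1.comp_left Complex.ofReal_zero
  set f : SchwartzMap ℝ ℂ := hc.toSchwartzMap (Complex.ofRealCLM.contDiff.comp h.1)
  have hf : 𝓕 (fun x => (ψ x : ℂ)) = (𝓕 f : SchwartzMap ℝ ℂ) := rfl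
  rw [hf]
  refine ⟨((𝓕 f).memLp 2 volume).integrable_norm_pow two_ne_zero, ?_⟩
  rw [SchwartzMap.integral_norm_sq_fourier]
  exact integral_congr_ae (ae_of_all _ fun x => show ‖(ψ x : ℂ)‖ ^ 2 = ψ x ^ 2 by simp)

lemma memLp_testFourier_one (ψ : testSpace) : MemLp (testFourier 1 ψ) 2 :=
  memLp_testFourier_of_integrable (by simpa using (testDeriv ψ).2.plancherel.1)

lemma memLp_testFourier_one_sub {β : ℝ} (h0 : 0 < β) (h1 : β < 1 / 2) (ψ : testSpace) :
    MemLp (testFourier (1 - β) ψ) 2 := by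
  have ⟨_, _, h⟩ := exists_energy_eq_integral_fourier (σ := 2 * β) (by linarith) (by linarith)
  refine memLp_testFourier_of_integrable ?_
  simpa only [show 2 * (1 - β) - 2 = -(2 * β) by ring] using
    (h _ (testDeriv ψ).2.integrable (testDeriv ψ).2.memLp).1

lemma norm_sq_lpMap_testFourier {μ : ℝ} (hμ : ∀ ψ, MemLp (testFourier μ ψ) 2) (ψ : testSpace) :
    ‖lpMap _ hμ ψ‖ ^ 2 = ((2 * Real.pi) ^ 2)⁻¹ *
      ∫ y, |y| ^ (2 * μ - 2) * ‖𝓕 (fun x => ((testDeriv ψ).1 x : ℂ)) y‖ ^ 2 := by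
  rw [← integral_norm_sq_testFourier, norm_sq_eq_integral]
  exact integral_congr_ae ((coeFn_lpMap hμ ψ).mono fun y hy => by simp only [hy])

lemma exists_mem_closure_range_prod_of_norm_sq_le {V X Y Z : Type*} [AddCommGroup V] [Module ℝ V]
    [NormedAddCommGroup X] [NormedSpace ℝ X] [NormedAddCommGroup Y] [NormedSpace ℝ Y]
    [NormedAddCommGroup Z] [NormedSpace ℝ Z] [CompleteSpace Z] {J : V →ₗ[ℝ] X} {S : V →ₗ[ℝ] Y}
    {T : V →ₗ[ℝ] Z} {M : ℝ} (hM : ∀ v, ‖T v‖ ^ 2 ≤ M * ‖S v‖ ^ 2) {x : X} {y : Y}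
    (h : (x, y) ∈ closure (range (J.prod S))) : ∃ z, (x, z) ∈ closure (range (J.prod T)) := by
  obtain ⟨p, hp, hlim⟩ := mem_closure_iff_seq_limit.1 h
  choose v hv using hp
  obtain rfl : (fun n => J.prod S (v n)) = p := funext hv
  rw [nhds_prod_eq, Filter.tendsto_prod_iff'] at hlim
  have hle (w : V) : ‖T w‖ ≤ √M * ‖S w‖ := by
    rw [← Real.sqrt_sq (norm_nonneg (S w)), ← Real.sqrt_mul' _ (sq_nonneg _)]
    exact Real.le_sqrt_of_sq_le (hM w)
  have hcauchy : CauchySeq fun n => T (v n) := by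
    refine cauchySeq_iff_tendsto_dist_atTop_0.2 (squeeze_zero (fun _ => dist_nonneg) (fun n => ?_)
      (by simpa using (cauchySeq_iff_tendsto_dist_atTop_0.1 hlim.2.cauchySeq).const_mul √M))
    simpa only [dist_eq_norm, map_sub, LinearMap.prod_apply, Function.prod] using
      hle (v n.1 - v n.2)
  obtain ⟨z, hz⟩ := cauchySeq_tendsto_of_complete hcauchy
  exact ⟨z, mem_closure_of_tendsto (hlim.1.prodMk_nhds hz) (.of_forall fun n => mem_range_self _)⟩

lemma ennreal_sqrt_sq (c : ℝ≥0∞) : (c ^ 2) ^ (1 / 2 : ℝ) = c := by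
  rw [← ENNReal.rpow_natCast, ← ENNReal.rpow_mul]
  norm_num

lemma max_le_sqrt_add_sq (a b : ℝ≥0∞) : max a b ≤ (a ^ 2 + b ^ 2) ^ (1 / 2 : ℝ) := by
  refine max_le ?_ ?_
  · exact (ennreal_sqrt_sq a).symm.trans_le
      (ENNReal.rpow_le_rpow le_self_add (by norm_num))
  · exact (ennreal_sqrt_sq b).symm.trans_le
      (ENNReal.rpow_le_rpow le_add_self (by norm_num))

lemma sqrt_add_sq_le_two_mul_max (a b : ℝ≥0∞) :
    (a ^ 2 + b ^ 2) ^ (1 / 2 : ℝ) ≤ 2 * max a b := by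
  rw [← ennreal_sqrt_sq (2 * max a b)]
  refine ENNReal.rpow_le_rpow ?_ (by norm_num)
  calc a ^ 2 + b ^ 2 ≤ max a b ^ 2 + max a b ^ 2 := by
        gcongr
        exacts [le_max_left .., le_max_right ..]
    _ ≤ (max a b + max a b) ^ 2 := by rw [add_sq, add_right_comm]; exact le_self_add
    _ = (2 * max a b) ^ 2 := by rw [two_mul]

lemma eLpNorm_sub_eq_edist {α E : Type*} [MeasurableSpace α] {μ : Measure α}
    [NormedAddCommGroup E] {p : ℝ≥0∞} {u v : Lp E p μ} {f g : α → E} (hf : u =ᵐ[μ] f)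
    (hg : v =ᵐ[μ] g) : eLpNorm (f - g) p μ = edist u v := by
  rw [Lp.edist_def]
  exact eLpNorm_congr_ae (hf.symm.sub hg.symm)

section

variable {μ : ℝ} (hμ : ∀ ψ, MemLp (testFourier μ ψ) 2)

lemma sobolevNorm_zeroExt_sub {φ : L2} {s : Lp ℂ 2 volume}
    (hs : s =ᵐ[volume] weightedFourier μ (zeroExt φ)) (ψ : testSpace) :
    sobolevNorm μ (fun x => ((zeroExt φ x - ψ.1 x : ℝ) : ℂ)) =
      (edist φ (testClass ψ) ^ 2 + edist s (lpMap _ hμ ψ) ^ 2) ^ (1 / 2 : ℝ) := by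
  have hfst : eLpNorm (fun x => ((zeroExt φ x - ψ.1 x : ℝ) : ℂ)) 2 = edist φ (testClass ψ) := by
    have hext : zeroExt φ - ψ.1 = (Ioo (0 : ℝ) 1).indicator (⇑φ - ψ.1) := by
      rw [indicator_sub', ← zeroExt, ← zeroExt, ψ.2.zeroExt_eq]
    rw [← eLpNorm_sub_eq_edist .rfl (coeFn_testClass ψ),
      ← eLpNorm_indicator_eq_eLpNorm_restrict measurableSet_Ioo, ← hext]
    exact eLpNorm_congr_norm_ae (ae_of_all _ fun x => Complex.norm_real _)
  have hsnd : eLpNorm (weightedFourier μ (zeroExt φ - ψ.1)) 2 = edist s (lpMap _ hμ ψ) := by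
    rw [weightedFourier_sub (integrable_zeroExt φ) ψ.2.integrable]
    exact eLpNorm_sub_eq_edist hs (coeFn_lpMap hμ ψ)
  rw [sobolevNorm, hfst, ← hsnd]
  rfl

include hμ in
lemma memLp_weightedFourier_of_mem_H0 {φ : L2} (hφ : φ ∈ H0 μ) :
    MemLp (weightedFourier μ (zeroExt φ)) 2 := by
  obtain ⟨ψ, hψ, hlt⟩ := hφ 1 one_pos
  have hdiff : MemLp (weightedFourier μ (zeroExt φ - ψ)) 2 :=
    ⟨aestronglyMeasurable_weightedFourier ((integrable_zeroExt φ).sub hψ.integrable),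
      (((le_max_right _ _).trans (max_le_sqrt_add_sq _ _)).trans_lt hlt).trans ENNReal.one_lt_top⟩
  have := hdiff.add (hμ ⟨ψ, hψ⟩)
  rwa [weightedFourier_sub (integrable_zeroExt φ) hψ.integrable, testFourier,
    LinearMap.coe_mk, AddHom.coe_mk, sub_add_cancel] at this

lemma ae_eq_weightedFourier_of_mem_closure {φ : L2} {s : Lp ℂ 2 volume}
    (h : (φ, s) ∈ closure (range (testClass.prod (lpMap _ hμ)))) :
    s =ᵐ[volume] weightedFourier μ (zeroExt φ) := by
  refine closure_minimal (range_subset_iff.2 fun ψ => ?_) ((isClosed_setOf_ae_eq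
    (continuous_weightedFourier_zeroExt μ)).preimage continuous_swap) h
  refine (coeFn_lpMap hμ ψ).trans (.of_eq (weightedFourier_congr ?_))
  exact .trans (.of_eq ψ.2.zeroExt_eq.symm) (zeroExt_congr_ae (coeFn_testClass ψ)).symm

lemma mem_H0_iff_exists_mem_closure {φ : L2} :
    φ ∈ H0 μ ↔ ∃ s, (φ, s) ∈ closure (range (testClass.prod (lpMap _ hμ))) := by
  constructor
  · intro hφ
    have hs := memLp_weightedFourier_of_mem_H0 hμ hφ
    refine ⟨hs.toLp, EMetric.mem_closure_iff.2 fun ε hε => ?_⟩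
    obtain ⟨ψ, hψ, hlt⟩ := hφ ε hε
    rw [sobolevNorm_zeroExt_sub hμ hs.coeFn_toLp ⟨ψ, hψ⟩] at hlt
    refine ⟨_, mem_range_self ⟨ψ, hψ⟩, ?_⟩
    rw [Prod.edist_eq]
    exact (max_le_sqrt_add_sq _ _).trans_lt hlt
  · rintro ⟨s, hs⟩ ε hε
    obtain ⟨_, ⟨ψ, rfl⟩, hlt⟩ := EMetric.mem_closure_iff.1 hs (ε / 2) (ENNReal.half_pos hε.ne')
    refine ⟨ψ, ψ.2, ?_⟩
    rw [sobolevNorm_zeroExt_sub hμ (ae_eq_weightedFourier_of_mem_closure hμ hs) ψ]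
    rw [Prod.edist_eq] at hlt
    exact (sqrt_add_sq_le_two_mul_max _ _).trans_lt (ENNReal.mul_lt_of_lt_div' hlt)

lemma mem_H0_iff_exists_mem_closure_of_norm_sq_le {Z : Type*} [NormedAddCommGroup Z]
    [NormedSpace ℝ Z] [CompleteSpace Z] {T : testSpace →ₗ[ℝ] Z} {M N : ℝ}
    (hM : ∀ ψ, ‖T ψ‖ ^ 2 ≤ M * ‖lpMap _ hμ ψ‖ ^ 2)
    (hN : ∀ ψ, ‖lpMap _ hμ ψ‖ ^ 2 ≤ N * ‖T ψ‖ ^ 2) {φ : L2} :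
    φ ∈ H0 μ ↔ ∃ z, (φ, z) ∈ closure (range (testClass.prod T)) :=
  (mem_H0_iff_exists_mem_closure hμ).trans
    ⟨fun ⟨_, h⟩ => exists_mem_closure_range_prod_of_norm_sq_le hM h,
      fun ⟨_, h⟩ => exists_mem_closure_range_prod_of_norm_sq_le hN h⟩

end

lemma mem_H0_one_iff {w : L2} :
    w ∈ H0 1 ↔ ∃ w', (w, w') ∈ closure (range (testClass.prod (testClass ∘ₗ testDeriv))) := by
  have h (ψ : testSpace) : ‖testClass (testDeriv ψ)‖ ^ 2 =
      (2 * Real.pi) ^ 2 * ‖lpMap _ memLp_testFourier_one ψ‖ ^ 2 := by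
    have hψ := (testDeriv ψ).2
    calc ‖testClass (testDeriv ψ)‖ ^ 2 = ∫ x, (testDeriv ψ).1 x ^ 2 ∂vol01 := by
          simp only [norm_sq_eq_integral, Real.norm_eq_abs, sq_abs]
          refine integral_congr_ae ((coeFn_testClass (testDeriv ψ)).mono fun x hx => ?_)
          simp only [hx]
      _ = ∫ x, (testDeriv ψ).1 x ^ 2 :=
          setIntegral_eq_integral_of_forall_compl_eq_zero fun x hx => by simp [hψ.eq_zero hx]
      _ = _ := by
          rw [norm_sq_lpMap_testFourier, mul_inv_cancel_left₀ (by positivity)]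
          simpa using hψ.plancherel.2.symm
  refine mem_H0_iff_exists_mem_closure_of_norm_sq_le memLp_testFourier_one (fun ψ => (h ψ).le)
    (N := ((2 * Real.pi) ^ 2)⁻¹) fun ψ => ?_
  rw [LinearMap.comp_apply, h, inv_mul_cancel_left₀ (by positivity)]

lemma mem_H0_one_sub_iff {β : ℝ} (h0 : 0 < β) (h1 : β < 1 / 2) {φ : L2} :
    φ ∈ H0 (1 - β) ↔ ∃ d, (φ, d) ∈ fracGraph h0 h1 := by
  obtain ⟨C, hC, hE⟩ := exists_energy_eq_integral_fourier (σ := 2 * β) (by linarith) (by linarith)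
  obtain ⟨c, _, hle⟩ := exists_norm_sq_fracPair_le (h0 := h0) (h1 := h1)
  have henergy (ψ : testSpace) : energy (2 * β) (testDeriv ψ) =
      C * (2 * Real.pi) ^ 2 * ‖lpMap _ (memLp_testFourier_one_sub h0 h1) ψ‖ ^ 2 := by
    rw [norm_sq_lpMap_testFourier, (hE _ (testDeriv ψ).2.integrable (testDeriv ψ).2.memLp).2,
      mul_assoc, mul_inv_cancel_left₀ (by positivity), show 2 * (1 - β) - 2 = -(2 * β) by ring]
  refine mem_H0_iff_exists_mem_closure_of_norm_sq_le (memLp_testFourier_one_sub h0 h1)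
    (T := fracPair h0 h1) (M := c * (C * (2 * Real.pi) ^ 2)) (N := (C * (2 * Real.pi) ^ 2)⁻¹)
    (fun ψ => ?_) fun ψ => ?_
  · rw [mul_assoc c, ← henergy, Prod.norm_def]
    rcases max_choice ‖(fracPair h0 h1 ψ).1‖ ‖(fracPair h0 h1 ψ).2‖ with h | h <;> rw [h]
    exacts [(hle ψ).1, (hle ψ).2]
  · rw [le_inv_mul_iff₀ (by positivity), ← henergy, ← inner_fracPair (h0 := h0) (h1 := h1), sq]
    exact (real_inner_le_norm _ _).trans (mul_le_mul (norm_fst_le _) (norm_snd_le _)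
      (norm_nonneg _) (norm_nonneg _))

lemma IsTest.integral_mul_vol01 {ψ : ℝ → ℝ} (hψ : IsTest ψ) (f : ℝ → ℝ) :
    ∫ x, f x * ψ x = ∫ x, f x * ψ x ∂vol01 :=
  (setIntegral_eq_integral_of_forall_compl_eq_zero fun x hx => by
    rw [hψ.eq_zero hx, mul_zero]).symm

lemma inner_testClass (u : L2) (ψ : testSpace) :
    inner ℝ u (testClass ψ) = ∫ x, u x * ψ.1 x ∂vol01 := by
  rw [inner_eq_integral]
  exact integral_congr_ae ((coeFn_testClass ψ).mono fun x hx => by simp only [hx])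

lemma eq_zero_of_inner_testClass {f : L2} (h : ∀ ψ, inner ℝ f (testClass ψ) = 0) : f = 0 := by
  have hae : ∀ᵐ x, x ∈ Ioo (0 : ℝ) 1 → f x = 0 :=
    isOpen_Ioo.ae_eq_zero_of_integral_contDiff_smul_eq_zero
      (IntegrableOn.locallyIntegrableOn (integrable_coe f)) fun ψ hd hc hs => by
        have hψ : IsTest ψ := ⟨hd, hc, hs⟩
        rw [← h ⟨ψ, hψ⟩, inner_testClass, ← hψ.integral_mul_vol01]
        simp only [smul_eq_mul, mul_comm]
  exact (Lp.eq_zero_iff_ae_eq_zero).2 ((ae_restrict_iff' measurableSet_Ioo).2 hae)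

/-- The constant function `1` as an element of `L²(0,1)`. -/
def oneL2 : L2 := Lp.const 2 vol01 1

lemma coeFn_oneL2 : oneL2 =ᵐ[vol01] fun _ => 1 := Lp.coeFn_const ..

lemma coeFn_smul_oneL2 (c : ℝ) : ⇑(c • oneL2) =ᵐ[vol01] fun _ => c := by
  filter_upwards [Lp.coeFn_smul c oneL2, coeFn_oneL2] with x h₁ h₂
  rw [h₁, Pi.smul_apply, h₂, smul_eq_mul, mul_one]

lemma inner_oneL2_testClass (ψ : testSpace) : inner ℝ oneL2 (testClass ψ) = ∫ x, ψ.1 x := by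
  calc inner ℝ oneL2 (testClass ψ) = ∫ x, 1 * ψ.1 x ∂vol01 := by
        rw [inner_testClass]
        exact integral_congr_ae (coeFn_oneL2.mono fun x hx => by simp only [hx])
    _ = ∫ x, ψ.1 x := by rw [← ψ.2.integral_mul_vol01 fun _ => 1]; simp only [one_mul]

lemma inner_oneL2 (f : L2) : inner ℝ oneL2 f = ∫ x, f x ∂vol01 := by
  rw [inner_eq_integral]
  exact integral_congr_ae (coeFn_oneL2.mono fun x hx => by simp only [hx, one_mul])

lemma inner_oneL2_self : inner ℝ oneL2 oneL2 = 1 := by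
  rw [inner_oneL2, integral_congr_ae coeFn_oneL2]
  simp

lemma leftI_one_eq_add_intervalIntegral {f : ℝ → ℝ} (hf : Integrable f) (x : ℝ) :
    leftI 1 f x = leftI 1 f 0 + ∫ s in 0..x, f s := by
  rw [leftI_one, leftI_one, ← integral_Iic_eq_integral_Iio, ← integral_Iic_eq_integral_Iio,
    ← intervalIntegral.integral_Iic_sub_Iic hf.integrableOn hf.integrableOn, add_sub_cancel]

lemma continuous_leftI_one {f : ℝ → ℝ} (hf : Integrable f) : Continuous (leftI 1 f) := by
  rw [funext (leftI_one_eq_add_intervalIntegral hf)]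
  exact continuous_const.add
    (intervalIntegral.continuous_primitive (fun _ _ => hf.intervalIntegrable) 0)

lemma hasDerivAt_leftI_one {f : ℝ → ℝ} (hf : Integrable f) (hc : Continuous f) (x : ℝ) :
    HasDerivAt (leftI 1 f) (f x) x := by
  rw [funext (leftI_one_eq_add_intervalIntegral hf)]
  exact (hc.integral_hasStrictDerivAt 0 x).hasDerivAt.const_add _

lemma exists_subset_Icc_of_isCompact {s : Set ℝ} {u v : ℝ} (hs : IsCompact s) (h : s ⊆ Ioo u v) :
    ∃ a b : ℝ, u < a ∧ b < v ∧ s ⊆ Icc a b := by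
  rcases s.eq_empty_or_nonempty with rfl | hne
  · exact ⟨u + 1, v - 1, by simp⟩
  · obtain ⟨a, ha⟩ := hs.exists_isLeast hne
    obtain ⟨b, hb⟩ := hs.exists_isGreatest hne
    exact ⟨a, b, (h ha.1).1, (h hb.1).2, fun x hx => ⟨ha.2 hx, hb.2 hx⟩⟩

lemma isTest_leftI_one {ψ : ℝ → ℝ} (hψ : IsTest ψ) (h0 : ∫ x, ψ x = 0) : IsTest (leftI 1 ψ) := by
  have hderiv := hasDerivAt_leftI_one hψ.integrable hψ.continuous
  obtain ⟨a, b, ha, hb, hab⟩ := exists_subset_Icc_of_isCompact hψ.2.1 hψ.2.2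
  have hout {t : ℝ} (ht : t ∉ Icc a b) : ψ t = 0 :=
    image_eq_zero_of_notMem_tsupport fun h => ht (hab h)
  have hsupp : tsupport (leftI 1 ψ) ⊆ Icc a b := by
    refine closure_minimal (fun x hx => ?_) isClosed_Icc
    contrapose! hx
    rw [Function.notMem_support, leftI_one]
    rcases not_and_or.1 hx with hxa | hxb
    · exact setIntegral_eq_zero_of_forall_eq_zero fun t ht =>
        hout fun h => hxa (h.1.trans (mem_Iio.1 ht).le)
    · rw [setIntegral_eq_integral_of_forall_compl_eq_zero, h0]
      exact fun t ht => hout fun h => hxb ((not_lt.1 ht).trans h.2)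
  refine ⟨?_, isCompact_Icc.of_isClosed_subset (isClosed_tsupport _) hsupp,
    hsupp.trans (Icc_subset_Ioo ha hb)⟩
  rw [contDiff_infty_iff_deriv, funext fun x => (hderiv x).deriv]
  exact ⟨fun x => (hderiv x).differentiableAt, hψ.1⟩

lemma exists_testDeriv_eq {ψ : testSpace} (h0 : inner ℝ oneL2 (testClass ψ) = 0) :
    ∃ Ψ, testDeriv Ψ = ψ := by
  have hψ : ∫ x, ψ.1 x = 0 := by
    rw [← h0, ← inner_oneL2_testClass]
  exact ⟨⟨leftI 1 ψ.1, isTest_leftI_one ψ.2 hψ⟩, Subtype.ext <| funext fun x =>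
    (hasDerivAt_leftI_one ψ.2.integrable ψ.2.continuous x).deriv⟩

lemma exists_testSpace_inner_oneL2_eq_one :
    ∃ η : testSpace, inner ℝ oneL2 (testClass η) = 1 := by
  by_contra! h
  have hone : oneL2 = 0 := eq_zero_of_inner_testClass fun ψ => by
    by_contra hψ
    refine h ((inner ℝ oneL2 (testClass ψ) : ℝ)⁻¹ • ψ) ?_
    rw [map_smul, inner_smul_right, inv_mul_cancel₀ hψ]
  have := inner_oneL2_self
  simp [hone] at this

lemma exists_eq_smul_oneL2 {f : L2} (h : ∀ ψ, inner ℝ f (testClass (testDeriv ψ)) = 0) :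
    ∃ c : ℝ, f = c • oneL2 := by
  obtain ⟨η, hη⟩ := exists_testSpace_inner_oneL2_eq_one
  refine ⟨inner ℝ f (testClass η), sub_eq_zero.1 (eq_zero_of_inner_testClass fun ψ => ?_)⟩
  obtain ⟨Ψ, hΨ⟩ := exists_testDeriv_eq (ψ := ψ - (inner ℝ oneL2 (testClass ψ) : ℝ) • η)
    (by rw [map_sub, map_smul, inner_sub_right, inner_smul_right, hη, mul_one, sub_self])
  have hf := h Ψ
  rw [hΨ, map_sub, map_smul, inner_sub_right, inner_smul_right] at hf
  rw [inner_sub_left, real_inner_smul_left, mul_comm, hf]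

lemma leftI_one_zeroExt_zero (γ : L2) : leftI 1 (zeroExt γ) 0 = 0 :=
  leftI_of_nonpos (fun _ hs => zeroExt_of_notMem fun h => hs.not_gt h.1) le_rfl

lemma leftI_one_zeroExt_one (γ : L2) : leftI 1 (zeroExt γ) 1 = inner ℝ oneL2 γ := by
  rw [inner_oneL2, leftI_one, zeroExt, setIntegral_indicator measurableSet_Ioo,
    inter_eq_right.2 fun x hx => hx.2]

/-- The primitive in `L²(0,1)` that vanishes at `0`. -/
def primitive : L2 →ₗ[ℝ] L2 :=
  lpMap
    { toFun := fun γ => leftI 1 (zeroExt γ)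
      map_add' := fun γ δ => funext fun x => by
        simp only [leftI_zeroExt_eq_inner (by norm_num : (1 / 2 : ℝ) < 1) le_rfl, inner_add_right,
          Pi.add_apply]
      map_smul' := fun c γ => funext fun x => by
        simp only [leftI_zeroExt_eq_inner (by norm_num : (1 / 2 : ℝ) < 1) le_rfl, inner_smul_right,
          Pi.smul_apply, RingHom.id_apply, smul_eq_mul] }
    fun γ => by
      obtain ⟨B, hB⟩ := exists_abs_leftI_zeroExt_le (by norm_num : (1 / 2 : ℝ) < 1) le_rfl
      exact .of_bound (continuous_leftI_one (integrable_zeroExt γ)).aestronglyMeasurable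
        (B * ‖γ‖) ((ae_restrict_iff' measurableSet_Ioo).2
          (ae_of_all _ fun x hx => hB γ x (Ioo_subset_Icc_self hx)))

lemma coeFn_primitive (γ : L2) : primitive γ =ᵐ[vol01] leftI 1 (zeroExt γ) := coeFn_lpMap _ γ

lemma inner_primitive_testDeriv (γ : L2) (ψ : testSpace) :
    inner ℝ (primitive γ) (testClass (testDeriv ψ)) = -inner ℝ γ (testClass ψ) := by
  have hψ := (testDeriv ψ).2
  calc inner ℝ (primitive γ) (testClass (testDeriv ψ))
    _ = ∫ x, leftI 1 (zeroExt γ) x * (testDeriv ψ).1 x := by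
      rw [inner_testClass, hψ.integral_mul_vol01]
      exact integral_congr_ae ((coeFn_primitive γ).mono fun x hx => by simp only [hx])
    _ = ∫ x, zeroExt γ x * rightI 1 (testDeriv ψ) x := by
      simp only [mul_comm (leftI 1 _ _)]
      exact integral_mul_leftI one_pos le_rfl hψ.integrable hψ.memLp (integrable_zeroExt γ)
        (memLp_zeroExt γ)
    _ = -inner ℝ γ (testClass ψ) := by
      simp only [rightI_one_testDeriv, mul_neg, integral_neg, integral_zeroExt_mul,
        inner_testClass]

lemma leftI_one_zeroExt_testDeriv (ψ : testSpace) (x : ℝ) :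
    leftI 1 (zeroExt (testClass (testDeriv ψ))) x = ψ.1 x := by
  rw [leftI_congr (zeroExt_congr_ae (coeFn_testClass _)), (testDeriv ψ).2.zeroExt_eq,
    leftI_one_testDeriv]

lemma inner_oneL2_testDeriv (ψ : testSpace) : inner ℝ oneL2 (testClass (testDeriv ψ)) = 0 := by
  rw [← leftI_one_zeroExt_one, leftI_one_zeroExt_testDeriv, ψ.2.eq_zero fun h => h.2.false]

lemma hasWeakDeriv_iff_inner {w w' : L2} : HasWeakDeriv w w' ↔
    ∀ ψ, inner ℝ w (testClass (testDeriv ψ)) = -inner ℝ w' (testClass ψ) := by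
  simp only [HasWeakDeriv, inner_testClass, Subtype.forall]
  rfl

lemma hasWeakDeriv_iff {w w' : L2} :
    HasWeakDeriv w w' ↔ ∃ c : ℝ, w = c • oneL2 + primitive w' := by
  rw [hasWeakDeriv_iff_inner]
  constructor
  · intro h
    obtain ⟨c, hc⟩ := exists_eq_smul_oneL2 (f := w - primitive w') fun ψ => by
      rw [inner_sub_left, h, inner_primitive_testDeriv, sub_self]
    exact ⟨c, sub_eq_iff_eq_add.1 hc⟩
  · rintro ⟨c, rfl⟩ ψ
    rw [inner_add_left, real_inner_smul_left, inner_oneL2_testDeriv, mul_zero, zero_add,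
      inner_primitive_testDeriv]

lemma eq_zero_of_primitive_eq_smul_oneL2 {γ : L2} {c : ℝ} (h : primitive γ = c • oneL2) :
    γ = 0 := by
  refine eq_zero_of_inner_testClass fun ψ => ?_
  rw [← neg_eq_zero, ← inner_primitive_testDeriv, h, real_inner_smul_left, inner_oneL2_testDeriv,
    mul_zero]

lemma primitive_injective : Function.Injective primitive :=
  (injective_iff_map_eq_zero _).2 fun _ h =>
    eq_zero_of_primitive_eq_smul_oneL2 (c := 0) (by rw [h, zero_smul])

lemma coeFn_primitive_oneL2 : primitive oneL2 =ᵐ[vol01] fun x => x := by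
  filter_upwards [coeFn_primitive oneL2, ae_restrict_mem measurableSet_Ioo] with x hx hx01
  rw [hx, leftI_congr (zeroExt_congr_ae coeFn_oneL2), leftI_one, zeroExt,
    setIntegral_indicator measurableSet_Ioo, Iio_inter_Ioo, min_eq_left hx01.2.le]
  simp [hx01.1.le]

lemma coeFn_smul_oneL2_add_primitive (c : ℝ) (γ : L2) :
    ⇑(c • oneL2 + primitive γ) =ᵐ[vol01] fun x => c + leftI 1 (zeroExt γ) x := by
  filter_upwards [Lp.coeFn_add (c • oneL2) (primitive γ), coeFn_smul_oneL2 c,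
    coeFn_primitive γ] with x h₁ h₂ h₃
  rw [h₁, Pi.add_apply, h₂, h₃]

lemma hasBoundaryValues_smul_oneL2_add_primitive_iff {c p q : ℝ} {γ : L2} :
    HasBoundaryValues (c • oneL2 + primitive γ) p q ↔ c = p ∧ c + inner ℝ oneL2 γ = q := by
  have hcont : Continuous fun x => c + leftI 1 (zeroExt γ) x :=
    continuous_const.add (continuous_leftI_one (integrable_zeroExt γ))
  have h0 := leftI_one_zeroExt_zero γ
  have h1 := leftI_one_zeroExt_one γ
  constructor
  · rintro ⟨f, hf, hae, rfl, rfl⟩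
    have heq : EqOn (fun x => c + leftI 1 (zeroExt γ) x) f (Icc 0 1) :=
      Measure.eqOn_Icc_of_ae_eq volume zero_ne_one (by
        rw [Measure.restrict_congr_set Ioo_ae_eq_Icc.symm]
        exact (coeFn_smul_oneL2_add_primitive c γ).symm.trans hae) hcont.continuousOn hf
    rw [← heq ⟨le_rfl, zero_le_one⟩, ← heq ⟨zero_le_one, le_rfl⟩]
    simp [h0, h1]
  · rintro ⟨rfl, rfl⟩
    exact ⟨_, hcont.continuousOn, coeFn_smul_oneL2_add_primitive c γ, by simp [h0], by simp [h1]⟩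

lemma exists_eq_primitive_of_mem_H0_one {w : L2} (hw : w ∈ H0 1) :
    ∃ γ, inner ℝ oneL2 γ = 0 ∧ w = primitive γ := by
  obtain ⟨γ, hγ⟩ := mem_H0_one_iff.1 hw
  have hσ : (1 / 2 : ℝ) < 1 := by norm_num
  let S : Set (L2 × L2) :=
    {p | p.1 =ᵐ[vol01] leftI 1 (zeroExt p.2)} ∩ {p | inner ℝ oneL2 p.2 = 0}
  have hS : IsClosed S := (isClosed_setOf_ae_eq (continuous_leftI_zeroExt hσ le_rfl)).inter
    (isClosed_eq (by fun_prop) continuous_const)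
  have hsub : closure (range (testClass.prod (testClass ∘ₗ testDeriv))) ⊆ S := by
    refine closure_minimal (range_subset_iff.2 fun ψ => ⟨?_, inner_oneL2_testDeriv ψ⟩) hS
    refine (coeFn_testClass ψ).trans (ae_of_all _ fun x => ?_)
    exact (leftI_one_zeroExt_testDeriv ψ x).symm
  obtain ⟨hw, hγ⟩ : (w, γ) ∈ S := hsub hγ
  exact ⟨γ, hγ, Lp.ext (.trans hw (coeFn_primitive γ).symm)⟩

lemma testClass_mem_H0_one (ψ : testSpace) : testClass ψ ∈ H0 1 :=
  mem_H0_one_iff.2 ⟨_, subset_closure ⟨ψ, rfl⟩⟩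

lemma primitive_testDeriv (ψ : testSpace) : primitive (testClass (testDeriv ψ)) = testClass ψ :=
  Lp.ext <| (coeFn_primitive _).trans <|
    .trans (ae_of_all _ (leftI_one_zeroExt_testDeriv ψ)) (coeFn_testClass ψ).symm

lemma forall_inner_weakDeriv_eq_zero_iff {f : L2} :
    (∀ v ∈ H0 1, ∀ v', HasWeakDeriv v v' → inner ℝ f v' = 0) ↔ ∃ c : ℝ, f = c • oneL2 := by
  constructor
  · exact fun h => exists_eq_smul_oneL2 fun ψ => h _ (testClass_mem_H0_one ψ) _ <|
      hasWeakDeriv_iff.2 ⟨0, by rw [zero_smul, zero_add, primitive_testDeriv]⟩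
  · rintro ⟨c, rfl⟩ v hv v' hv'
    obtain ⟨γ, hγ, rfl⟩ := exists_eq_primitive_of_mem_H0_one hv
    obtain ⟨d, hd⟩ := hasWeakDeriv_iff.1 hv'
    have : γ - v' = 0 := eq_zero_of_primitive_eq_smul_oneL2 (c := d) (by
      rw [map_sub, sub_eq_iff_eq_add, ← hd])
    rw [← sub_eq_zero.1 this, real_inner_smul_left, hγ, mul_zero]

section WeakSolution

variable {K : ℝ → ℝ} {Km KM : ℝ}

lemma exists_forall_mul_ae_eq_const_iff (hKmeas : AEMeasurable K vol01) (hKm : 0 < Km)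
    (hK : ∀ᵐ x ∂vol01, Km ≤ K x) :
    ∃ k : L2, inner ℝ oneL2 k = 1 ∧ ∀ w' : L2,
      (∃ c : ℝ, (fun x => K x * w' x) =ᵐ[vol01] fun _ => c) ↔ ∃ c : ℝ, w' = c • k := by
  have hpos : ∀ᵐ x ∂vol01, 0 < K x := hK.mono fun x hx => hKm.trans_le hx
  have hmem : MemLp (fun x => (K x)⁻¹) 2 vol01 := by
    refine .of_bound hKmeas.inv.aestronglyMeasurable Km⁻¹ ?_
    filter_upwards [hK, hpos] with x hx hx0
    rw [Real.norm_of_nonneg (inv_nonneg.2 hx0.le)]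
    exact inv_anti₀ hKm hx
  have hI : 0 < ∫ x, (K x)⁻¹ ∂vol01 := by
    have hnonneg : 0 ≤ᵐ[vol01] fun x => (K x)⁻¹ := hpos.mono fun x hx => (inv_pos.2 hx).le
    refine (integral_nonneg_of_ae hnonneg).lt_of_ne' fun h => ?_
    rw [integral_eq_zero_iff_of_nonneg_ae hnonneg (hmem.integrable one_le_two)] at h
    obtain ⟨x, hx, hx0⟩ := (h.and hpos).exists
    exact (inv_pos.2 hx0).ne' hx
  refine ⟨(∫ x, (K x)⁻¹ ∂vol01)⁻¹ • hmem.toLp, ?_, fun w' => ⟨?_, ?_⟩⟩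
  · rw [inner_smul_right, inner_oneL2, integral_congr_ae hmem.coeFn_toLp, inv_mul_cancel₀ hI.ne']
  · rintro ⟨c, hc⟩
    refine ⟨c * ∫ x, (K x)⁻¹ ∂vol01, Lp.ext ?_⟩
    rw [smul_smul, mul_inv_cancel_right₀ hI.ne']
    filter_upwards [hc, Lp.coeFn_smul c hmem.toLp, hmem.coeFn_toLp, hpos] with x h₁ h₂ h₃ h₄
    rw [h₂, Pi.smul_apply, h₃, smul_eq_mul, ← h₁, mul_comm (K x), mul_inv_cancel_right₀ h₄.ne']
  · rintro ⟨c, rfl⟩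
    refine ⟨c * (∫ x, (K x)⁻¹ ∂vol01)⁻¹, ?_⟩
    rw [smul_smul]
    filter_upwards [Lp.coeFn_smul (c * (∫ x, (K x)⁻¹ ∂vol01)⁻¹) hmem.toLp, hmem.coeFn_toLp, hpos]
      with x h₁ h₂ h₃
    rw [h₁, Pi.smul_apply, h₂, smul_eq_mul, mul_left_comm, mul_inv_cancel₀ h₃.ne', mul_one]

lemma isWeakSolution_iff_exists {p q : ℝ} (hKmeas : AEMeasurable K vol01)
    (hK : ∀ᵐ x ∂vol01, ‖K x‖ ≤ KM) {w : L2} :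
    IsWeakSolution K p q w ↔ ∃ w' : L2, w = p • oneL2 + primitive w' ∧ p + inner ℝ oneL2 w' = q ∧
      ∃ c : ℝ, (fun x => K x * w' x) =ᵐ[vol01] fun _ => c := by
  refine exists_congr fun w' => ?_
  have hKw : MemLp (fun x => K x * w' x) 2 vol01 :=
    (Lp.memLp w').of_le_mul (hKmeas.aestronglyMeasurable.mul (Lp.aestronglyMeasurable w'))
      (hK.mono fun x hx => by
        rw [norm_mul]
        exact mul_le_mul_of_nonneg_right hx (norm_nonneg _))
  have hweak : (∀ v ∈ H0 1, ∀ v' : L2, HasWeakDeriv v v' → ∫ x, K x * w' x * v' x ∂vol01 = 0) ↔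
      ∃ c : ℝ, (fun x => K x * w' x) =ᵐ[vol01] fun _ => c := by
    have hinner (v' : L2) : ∫ x, K x * w' x * v' x ∂vol01 = inner ℝ hKw.toLp v' := by
      rw [inner_eq_integral]
      exact integral_congr_ae (hKw.coeFn_toLp.mono fun x hx => by simp only [hx])
    simp only [hinner, forall_inner_weakDeriv_eq_zero_iff]
    exact exists_congr fun c => Lp.ext_iff.trans
      ⟨fun h => hKw.coeFn_toLp.symm.trans (h.trans (coeFn_smul_oneL2 c)),
        fun h => hKw.coeFn_toLp.trans (h.trans (coeFn_smul_oneL2 c).symm)⟩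
  rw [hweak, hasWeakDeriv_iff]
  constructor
  · rintro ⟨⟨c, rfl⟩, hbv, h⟩
    obtain ⟨rfl, rfl⟩ := hasBoundaryValues_smul_oneL2_add_primitive_iff.1 hbv
    exact ⟨rfl, rfl, h⟩
  · rintro ⟨rfl, h, h'⟩
    exact ⟨⟨p, rfl⟩, hasBoundaryValues_smul_oneL2_add_primitive_iff.2 ⟨rfl, h⟩, h'⟩

lemma exists_forall_isWeakSolution_iff (hKmeas : AEMeasurable K vol01) (hKm : 0 < Km)
    (hK : ∀ᵐ x ∂vol01, Km ≤ K x ∧ K x ≤ KM) :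
    ∃ k : L2, inner ℝ oneL2 k = 1 ∧ ∀ (p q : ℝ) (w : L2),
      IsWeakSolution K p q w ↔ w = p • oneL2 + (q - p) • primitive k := by
  obtain ⟨k, hk, hKk⟩ := exists_forall_mul_ae_eq_const_iff hKmeas hKm (hK.mono fun x hx => hx.1)
  have hnorm : ∀ᵐ x ∂vol01, ‖K x‖ ≤ KM :=
    hK.mono fun x hx => by rw [Real.norm_of_nonneg (hKm.le.trans hx.1)]; exact hx.2
  refine ⟨k, hk, fun p q w => ?_⟩
  simp only [isWeakSolution_iff_exists hKmeas hnorm, hKk]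
  constructor
  · rintro ⟨_, rfl, rfl, c, rfl⟩
    rw [inner_smul_right, hk, mul_one, add_sub_cancel_left, map_smul]
  · rintro rfl
    exact ⟨(q - p) • k, by rw [map_smul], by rw [inner_smul_right, hk]; ring, _, rfl⟩

end WeakSolution

lemma norm_sq_le_mul_inner_combo {E : Type*} [NormedAddCommGroup E] [InnerProductSpace ℝ E]
    {a b : E} {c θ : ℝ} (hc : 1 ≤ c) (h : ‖a‖ ^ 2 ≤ c * inner ℝ a b) (hθ0 : 0 ≤ θ) (hθ1 : θ ≤ 1) :
    ‖a‖ ^ 2 ≤ c * inner ℝ a (θ • a + (1 - θ) • b) :=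
  calc ‖a‖ ^ 2 = θ * ‖a‖ ^ 2 + (1 - θ) * ‖a‖ ^ 2 := by ring
    _ ≤ θ * (c * ‖a‖ ^ 2) + (1 - θ) * (c * inner ℝ a b) := by
      gcongr
      exact le_mul_of_one_le_left (sq_nonneg _) hc
    _ = c * inner ℝ a (θ • a + (1 - θ) • b) := by
      rw [inner_add_right, inner_smul_right, inner_smul_right, real_inner_self_eq_norm_sq]
      ring

lemma norm_le_mul_norm_of_norm_sq_le {E : Type*} [NormedAddCommGroup E] [InnerProductSpace ℝ E]
    {a f : E} {c : ℝ} (hc : 0 ≤ c) (h : ‖a‖ ^ 2 ≤ c * inner ℝ a f) : ‖a‖ ≤ c * ‖f‖ := by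
  rcases (norm_nonneg a).eq_or_lt with ha | ha
  · rw [← ha]
    positivity
  · refine le_of_mul_le_mul_left ?_ ha
    calc ‖a‖ * ‖a‖ = ‖a‖ ^ 2 := (sq _).symm
      _ ≤ c * (‖a‖ * ‖f‖) := h.trans (by gcongr; exact real_inner_le_norm _ _)
      _ = ‖a‖ * (c * ‖f‖) := by ring

lemma eq_zero_of_energy_eq_zero {σ : ℝ} (h0 : 0 < σ) (h1 : σ < 1) {f : L2}
    (hf : energy σ (zeroExt f) = 0) : f = 0 := by
  have hσ : 2 * (σ / 2) = σ := mul_div_cancel₀ σ two_ne_zero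
  obtain ⟨c, hc⟩ := exists_integral_leftI_sq (β := σ / 2) (by linarith) (by linarith)
  obtain ⟨hmem, hint⟩ := hc _ (integrable_zeroExt f) (memLp_zeroExt f)
  rw [hσ, hf, mul_zero, integral_eq_zero_iff_of_nonneg (fun _ => sq_nonneg _)
    hmem.integrable_sq] at hint
  have hzero : leftI (σ / 2) (zeroExt f) =ᵐ[volume] 0 := hint.mono fun x hx => by simpa using hx
  refine eq_zero_of_primitive_eq_smul_oneL2 (c := 0) (Lp.ext ((coeFn_primitive f).trans ?_))
  refine .trans (ae_of_all _ fun x => ?_) (coeFn_smul_oneL2 0).symm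
  rw [← leftI_one_sub_leftI (half_pos h0) (by linarith) (integrable_zeroExt f),
    leftI_congr hzero]
  simp [leftI]

section Solvability

variable {β : ℝ} {h0 : 0 < β} {h1 : β < 1 / 2}

lemma memLp_leftI_zeroExt (h0 : 0 < β) (h1 : β < 1 / 2) (h : L2) :
    MemLp (leftI β (zeroExt h)) 2 vol01 :=
  have ⟨_, hc⟩ := exists_integral_leftI_sq h0 h1
  (hc _ (integrable_zeroExt h) (memLp_zeroExt h)).1.restrict _

lemma memLp_rightI_zeroExt (h0 : 0 < β) (h1 : β < 1 / 2) (h : L2) :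
    MemLp (rightI β (zeroExt h)) 2 vol01 :=
  have ⟨_, hc⟩ := exists_integral_rightI_sq h0 h1
  (hc _ (integrable_zeroExt h) (memLp_zeroExt h)).1.restrict _

/-- The left fractional integral of order `β` as a map from `L²(0,1)` to itself. -/
def leftFracInt (h0 : 0 < β) (h1 : β < 1 / 2) (h : L2) : L2 := (memLp_leftI_zeroExt h0 h1 h).toLp

/-- The right fractional integral of order `β` as a map from `L²(0,1)` to itself. -/
def rightFracInt (h0 : 0 < β) (h1 : β < 1 / 2) (h : L2) : L2 := (memLp_rightI_zeroExt h0 h1 h).toLp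

lemma leftFracInt_testDeriv (ψ : testSpace) :
    leftFracInt h0 h1 (testClass (testDeriv ψ)) = (fracPair h0 h1 ψ).1 := by
  refine Lp.ext ((memLp_leftI_zeroExt h0 h1 _).coeFn_toLp.trans ?_)
  rw [leftI_congr (zeroExt_congr_ae (coeFn_testClass _)), (testDeriv ψ).2.zeroExt_eq]
  exact (coeFn_fracPair_fst h0 h1 ψ).symm

lemma rightFracInt_testDeriv (ψ : testSpace) :
    rightFracInt h0 h1 (testClass (testDeriv ψ)) = (fracPair h0 h1 ψ).2 := by
  refine Lp.ext ((memLp_rightI_zeroExt h0 h1 _).coeFn_toLp.trans ?_)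
  rw [rightI_congr (zeroExt_congr_ae (coeFn_testClass _)), (testDeriv ψ).2.zeroExt_eq]
  exact (coeFn_fracPair_snd h0 h1 ψ).symm

lemma inner_leftFracInt (f g : L2) :
    inner ℝ f (leftFracInt h0 h1 g) = ∫ x, zeroExt f x * leftI β (zeroExt g) x := by
  rw [integral_zeroExt_mul, inner_eq_integral]
  exact integral_congr_ae ((memLp_leftI_zeroExt h0 h1 g).coeFn_toLp.mono fun x hx => by
    simp only [leftFracInt, hx])

lemma inner_rightFracInt (f g : L2) :
    inner ℝ f (rightFracInt h0 h1 g) = inner ℝ g (leftFracInt h0 h1 f) := by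
  rw [inner_leftFracInt, integral_mul_leftI h0 (by linarith) (integrable_zeroExt g)
    (memLp_zeroExt g) (integrable_zeroExt f) (memLp_zeroExt f), integral_zeroExt_mul,
    inner_eq_integral]
  exact integral_congr_ae ((memLp_rightI_zeroExt h0 h1 g).coeFn_toLp.mono fun x hx => by
    simp only [rightFracInt, hx])

lemma inner_self_leftFracInt (f : L2) :
    inner ℝ f (leftFracInt h0 h1 f) = energy β (zeroExt f) := by
  rw [inner_leftFracInt]
  exact integral_mul_leftI_self h0 (by linarith) (integrable_zeroExt f) (memLp_zeroExt f)

/-- The operator which takes `φ ∈ H₀^{1-β}(0,1)` to `θ` times its left fractional derivative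
minus `1 - θ` times its right one, as a bounded operator on the graph. -/
def fracOp (h0 : 0 < β) (h1 : β < 1 / 2) (θ : ℝ) : fracGraph h0 h1 →L[ℝ] L2 :=
  (θ • (ContinuousLinearMap.fst ℝ L2 L2 ∘L ContinuousLinearMap.snd ℝ L2 (L2 × L2)) +
    (1 - θ) • (ContinuousLinearMap.snd ℝ L2 L2 ∘L ContinuousLinearMap.snd ℝ L2 (L2 × L2))) ∘L
      (fracGraph h0 h1).subtypeL

lemma fracOp_apply (θ : ℝ) (P : fracGraph h0 h1) :
    fracOp h0 h1 θ P = θ • P.1.2.1 + (1 - θ) • P.1.2.2 := rfl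

lemma exists_fracOp_eq (θ : ℝ) (ψ : testSpace) :
    ∃ P, fracOp h0 h1 θ P = θ • leftFracInt h0 h1 (testClass (testDeriv ψ)) +
      (1 - θ) • rightFracInt h0 h1 (testClass (testDeriv ψ)) :=
  ⟨⟨_, subset_closure ⟨ψ, rfl⟩⟩, by
    rw [leftFracInt_testDeriv, rightFracInt_testDeriv]
    rfl⟩

lemma eq_zero_of_forall_inner_fracOp_eq_zero {θ : ℝ} {h : L2}
    (hR : ∀ P, inner ℝ h (fracOp h0 h1 θ P) = 0) (hone : inner ℝ oneL2 h = 0) : h = 0 := by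
  obtain ⟨c, hc⟩ := exists_eq_smul_oneL2
    (f := θ • rightFracInt h0 h1 h + (1 - θ) • leftFracInt h0 h1 h) fun ψ => by
      obtain ⟨P, hP⟩ := exists_fracOp_eq (h0 := h0) (h1 := h1) θ ψ
      rw [← hR P, hP]
      simp only [inner_add_left, inner_add_right, real_inner_smul_left, inner_smul_right,
        inner_rightFracInt, real_inner_comm _ (rightFracInt h0 h1 h),
        real_inner_comm _ (leftFracInt h0 h1 h)]
  refine eq_zero_of_energy_eq_zero h0 (by linarith) ?_
  calc energy β (zeroExt h)
    _ = inner ℝ h (θ • rightFracInt h0 h1 h + (1 - θ) • leftFracInt h0 h1 h) := by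
      rw [inner_add_right, inner_smul_right, inner_smul_right, inner_rightFracInt,
        inner_self_leftFracInt]
      ring
    _ = 0 := by rw [hc, inner_smul_right, real_inner_comm, hone, mul_zero]

lemma exists_norm_fst_le_of_mem_fracGraph :
    ∃ B : ℝ, ∀ p ∈ fracGraph h0 h1, ‖p.1‖ ≤ B * ‖p.2.1‖ := by
  obtain ⟨B, hB⟩ := exists_abs_leftI_zeroExt_le (σ := 1 - β) (by linarith) (by linarith)
  refine ⟨B, fun p hp => ?_⟩
  have hbound : ∀ᵐ x ∂vol01, ‖p.1 x‖ ≤ B * ‖p.2.1‖ := by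
    filter_upwards [ae_eq_leftI_of_mem_fracGraph hp, ae_restrict_mem measurableSet_Ioo] with x hx hI
    rw [hx]
    exact hB _ x (Ioo_subset_Icc_self hI)
  have hnonneg : 0 ≤ B * ‖p.2.1‖ := (abs_nonneg _).trans (hB p.2.1 0 ⟨le_rfl, zero_le_one⟩)
  simpa [measureUnivNNReal] using Lp.norm_le_of_ae_bound hnonneg hbound

variable {θ : ℝ} (hθ0 : 0 ≤ θ) (hθ1 : θ ≤ 1)

include hθ0 hθ1

lemma exists_norm_le_mul_norm_fracOp : ∃ C : ℝ, ∀ P, ‖P‖ ≤ C * ‖fracOp h0 h1 θ P‖ := by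
  obtain ⟨B, hB⟩ := exists_norm_fst_le_of_mem_fracGraph (h0 := h0) (h1 := h1)
  obtain ⟨c, hc, h⟩ := exists_norm_sq_le_inner_of_mem_fracGraph (h0 := h0) (h1 := h1)
  refine ⟨max 1 B * c, fun ⟨p, hp⟩ => ?_⟩
  obtain ⟨hl, hr⟩ := h p hp
  rw [mul_assoc]
  set N := c * ‖fracOp h0 h1 θ ⟨p, hp⟩‖
  have hc0 : 0 ≤ c := zero_le_one.trans hc
  have hleft : ‖p.2.1‖ ≤ N :=
    norm_le_mul_norm_of_norm_sq_le hc0 (norm_sq_le_mul_inner_combo hc hl hθ0 hθ1)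
  have hright : ‖p.2.2‖ ≤ N := by
    refine norm_le_mul_norm_of_norm_sq_le hc0 ?_
    rw [real_inner_comm] at hr
    simpa [fracOp_apply, add_comm] using
      norm_sq_le_mul_inner_combo hc hr (sub_nonneg.2 hθ1) (sub_le_self 1 hθ0)
  have hN : N ≤ max 1 B * N :=
    le_mul_of_one_le_left ((norm_nonneg _).trans hleft) (le_max_left _ _)
  refine max_le ?_ (max_le (hleft.trans hN) (hright.trans hN))
  calc ‖p.1‖ ≤ B * ‖p.2.1‖ := hB p hp
    _ ≤ max 1 B * N := by gcongr; exact le_max_right _ _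

lemma fracOp_injective : Function.Injective (fracOp h0 h1 θ) := by
  obtain ⟨C, hC⟩ := exists_norm_le_mul_norm_fracOp (h0 := h0) (h1 := h1) hθ0 hθ1
  refine (injective_iff_map_eq_zero _).2 fun P hP => norm_le_zero_iff.1 ?_
  simpa [hP] using hC P

lemma isClosed_range_fracOp : IsClosed (range (fracOp h0 h1 θ)) := by
  obtain ⟨C, hC⟩ := exists_norm_le_mul_norm_fracOp (h0 := h0) (h1 := h1) hθ0 hθ1
  have : CompleteSpace (fracGraph h0 h1) :=
    (Submodule.isClosed_topologicalClosure _).completeSpace_coe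
  refine (AddMonoidHomClass.antilipschitz_of_bound (fracOp h0 h1 θ) (K := C.toNNReal) fun P =>
    (hC P).trans ?_).isClosed_range (fracOp h0 h1 θ).uniformContinuous
  gcongr
  exact Real.le_coe_toNNReal C

lemma range_fracOp_sup_span : (fracOp h0 h1 θ).range ⊔ ℝ ∙ oneL2 = ⊤ := by
  have hclosed : IsClosed (((fracOp h0 h1 θ).range ⊔ ℝ ∙ oneL2 : Submodule ℝ L2) : Set L2) :=
    Submodule.isClosed_sup_finiteDimensional _ _ (isClosed_range_fracOp hθ0 hθ1)
  rw [← hclosed.submodule_topologicalClosure_eq, Submodule.topologicalClosure_eq_top_iff,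
    ← Submodule.inf_orthogonal, eq_bot_iff]
  rintro h ⟨hR, hone⟩
  refine eq_zero_of_forall_inner_fracOp_eq_zero (h0 := h0) (h1 := h1) (θ := θ) (fun P => ?_)
    (Submodule.mem_orthogonal_singleton_iff_inner_right.1 hone)
  rw [real_inner_comm]
  exact hR _ ⟨P, rfl⟩

lemma range_fracOp_ne_top : (fracOp h0 h1 θ).range ≠ ⊤ := by
  intro htop
  have hσ : 1 / 2 < 1 - β := by linarith
  have hσ1 : 1 - β ≤ 1 := by linarith
  have hmem := memLp_kappa_const_sub hσ hσ1 1
  obtain ⟨⟨p, hp⟩, hP⟩ : hmem.toLp ∈ (fracOp h0 h1 θ).range := htop ▸ Submodule.mem_top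
  rw [ContinuousLinearMap.coe_coe, fracOp_apply] at hP
  obtain ⟨c, hc, h⟩ := exists_norm_sq_le_inner_of_mem_fracGraph (h0 := h0) (h1 := h1)
  have horth : inner ℝ p.2.1 hmem.toLp = 0 := by
    rw [real_inner_comm, ← leftI_zeroExt_eq_inner hσ hσ1, leftI_one_eq_zero_of_mem_fracGraph hp]
  have ha : p.2.1 = 0 := by
    have := norm_sq_le_mul_inner_combo hc (h p hp).1 hθ0 hθ1
    rw [hP, horth, mul_zero] at this
    simpa using this
  have hb : p.2.2 = 0 := by simpa [ha] using (h p hp).2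
  have hzero : (fun s => kappa (1 - β) (1 - s)) =ᵐ[vol01] 0 :=
    (MemLp.toLp_eq_toLp_iff hmem MemLp.zero').1 (by simp [← hP, ha, hb])
  obtain ⟨s, hs, hs01⟩ := (hzero.and (ae_restrict_mem measurableSet_Ioo)).exists
  replace hs : kappa (1 - β) (1 - s) = 0 := hs
  rw [kappa_of_pos (sub_pos.2 hs01.2)] at hs
  have := Real.rpow_pos_of_pos (sub_pos.2 hs01.2) (1 - β - 1)
  have := Real.Gamma_pos_of_pos (sub_pos.2 (h1.trans one_half_lt_one))
  exact (by positivity : (1 - s) ^ (1 - β - 1) / Real.Gamma (1 - β) ≠ 0) hs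

lemma oneL2_notMem_range_fracOp : oneL2 ∉ (fracOp h0 h1 θ).range := fun h =>
  range_fracOp_ne_top hθ0 hθ1 <| by
    rw [← range_fracOp_sup_span hθ0 hθ1, left_eq_sup, Submodule.span_singleton_le_iff_mem]
    exact h

lemma exists_fracOp_eq_add_smul (f : L2) :
    ∃ P, ∃ c : ℝ, fracOp h0 h1 θ P = f + c • oneL2 := by
  obtain ⟨_, ⟨P, rfl⟩, _, hc, hf⟩ :=
    Submodule.mem_sup.1 ((range_fracOp_sup_span hθ0 hθ1 : _ = ⊤) ▸ Submodule.mem_top (x := f))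
  obtain ⟨c, rfl⟩ := Submodule.mem_span_singleton.1 hc
  exact ⟨P, -c, by rw [← hf, neg_smul, add_neg_cancel_right]; rfl⟩

lemma eq_zero_of_fracOp_eq_smul {P : fracGraph h0 h1} {c : ℝ}
    (h : fracOp h0 h1 θ P = c • oneL2) : P = 0 := by
  have hc : c = 0 := by
    by_contra hc
    refine oneL2_notMem_range_fracOp (h0 := h0) (h1 := h1) hθ0 hθ1 ⟨c⁻¹ • P, ?_⟩
    rw [ContinuousLinearMap.coe_coe, map_smul, h, inv_smul_smul₀ hc]
  exact fracOp_injective hθ0 hθ1 (by rw [h, hc, zero_smul, map_zero])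

end Solvability

lemma leftInt_zero_eq_leftI (σ : ℝ) (w : ℝ → ℝ) {x : ℝ} (hx : x ∈ Icc (0 : ℝ) 1) :
    leftInt 0 σ w x = leftI σ (zeroExt w) x := by
  rw [leftInt, leftI, intervalIntegral.integral_of_le hx.1, integral_Ioc_eq_integral_Ioo,
    ← integral_indicator measurableSet_Ioo, ← integral_const_mul]
  refine integral_congr_ae (ae_of_all _ fun s => ?_)
  by_cases hs : s ∈ Ioo 0 x
  · have hxs : 0 < x - s := sub_pos.2 hs.2
    have hs01 : s ∈ Ioo (0 : ℝ) 1 := ⟨hs.1, hs.2.trans_le hx.2⟩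
    simp only [zeroExt, indicator_of_mem hs, indicator_of_mem hs01, kappa_of_pos hxs]
    rw [← neg_sub 1 σ, Real.rpow_neg hxs.le]
    ring
  · simp only [indicator_of_notMem hs, mul_zero]
    rw [eq_comm, mul_eq_zero]
    rcases le_or_gt x s with h | h
    · exact .inl (kappa_of_nonpos (sub_nonpos.2 h))
    · exact .inr (zeroExt_of_notMem fun h01 => hs ⟨h01.1, h⟩)

lemma rightInt_one_eq_rightI (σ : ℝ) (w : ℝ → ℝ) {x : ℝ} (hx : x ∈ Icc (0 : ℝ) 1) :
    rightInt 1 σ w x = rightI σ (zeroExt w) x := by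
  rw [rightInt, rightI, intervalIntegral.integral_of_le hx.2, integral_Ioc_eq_integral_Ioo,
    ← integral_indicator measurableSet_Ioo, ← integral_const_mul]
  refine integral_congr_ae (ae_of_all _ fun s => ?_)
  by_cases hs : s ∈ Ioo x 1
  · have hxs : 0 < s - x := sub_pos.2 hs.1
    have hs01 : s ∈ Ioo (0 : ℝ) 1 := ⟨hx.1.trans_lt hs.1, hs.2⟩
    simp only [zeroExt, indicator_of_mem hs, indicator_of_mem hs01, kappa_of_pos hxs]
    rw [← neg_sub 1 σ, Real.rpow_neg hxs.le]
    ring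
  · simp only [indicator_of_notMem hs, mul_zero]
    rw [eq_comm, mul_eq_zero]
    rcases le_or_gt s x with h | h
    · exact .inl (kappa_of_nonpos (sub_nonpos.2 h))
    · exact .inr (zeroExt_of_notMem fun h01 => hs ⟨h, h01.2⟩)

lemma rightI_one_zeroExt (γ : L2) (x : ℝ) :
    rightI 1 (zeroExt γ) x = inner ℝ oneL2 γ - leftI 1 (zeroExt γ) x := by
  have hγ := integrable_zeroExt γ
  rw [inner_oneL2, ← integral_indicator measurableSet_Ioo, eq_sub_iff_add_eq', leftI_one,
    rightI_one, ← integral_Iic_eq_integral_Iio]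
  exact intervalIntegral.integral_Iic_add_Ioi hγ.integrableOn hγ.integrableOn

lemma coeFn_sub_affine_ae_eq (p q : ℝ) (k : L2) :
    (fun x => (p • oneL2 + (q - p) • primitive k : L2) x - (p + (q - p) * x)) =ᵐ[vol01]
      primitive ((q - p) • (k - oneL2)) := by
  rw [← map_smul primitive]
  filter_upwards [coeFn_smul_oneL2_add_primitive p ((q - p) • k), coeFn_primitive oneL2,
    coeFn_primitive_oneL2, coeFn_primitive ((q - p) • (k - oneL2))] with x hw hone hx hγ
  rw [hw, hγ]
  rw [hone] at hx
  simp only [leftI_zeroExt_eq_inner (by norm_num : (1 / 2 : ℝ) < 1) le_rfl, inner_sub_right,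
    inner_smul_right] at hx ⊢
  linear_combination (q - p) * hx

section Correctors

variable {β θ : ℝ} {h0 : 0 < β} {h1 : β < 1 / 2}

lemma leftInt_zero_of_mem_fracGraph {p : L2 × L2 × L2} (hp : p ∈ fracGraph h0 h1) {x : ℝ}
    (hx : x ∈ Icc (0 : ℝ) 1) : leftInt 0 β p.1 x = leftI 1 (zeroExt p.2.1) x := by
  have hvanish : ∀ s ≤ 0, leftI (1 - β) (zeroExt p.2.1) s = 0 := fun s =>
    leftI_of_nonpos fun _ ht => zeroExt_of_notMem fun h => ht.not_gt h.1
  rw [leftInt_zero_eq_leftI β p.1 hx,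
    leftI_congr (zeroExt_congr_ae (ae_eq_leftI_of_mem_fracGraph hp)),
    leftI_zeroExt_of_le_one hvanish hx.2]
  simpa only [sub_sub_cancel] using leftI_one_sub_leftI (β := 1 - β) (by linarith) (by linarith)
    (integrable_zeroExt p.2.1) x

lemma rightInt_one_of_mem_fracGraph {p : L2 × L2 × L2} (hp : p ∈ fracGraph h0 h1) {x : ℝ}
    (hx : x ∈ Icc (0 : ℝ) 1) :
    rightInt 1 β p.1 x = leftI 1 (zeroExt p.2.2) x - inner ℝ oneL2 p.2.2 := by
  have hvanish : ∀ s, 1 ≤ s → -rightI (1 - β) (zeroExt p.2.2) s = 0 := fun s hs =>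
    neg_eq_zero.2 (rightI_of_one_le (fun _ ht => zeroExt_of_notMem fun h => ht.not_gt h.2) hs)
  have hneg : rightI β (fun s => -rightI (1 - β) (zeroExt p.2.2) s) x =
      -rightI 1 (zeroExt p.2.2) x := by
    rw [← rightI_one_sub_rightI (β := 1 - β) (by linarith) (by linarith)
      (integrable_zeroExt p.2.2) x, sub_sub_cancel]
    simp only [rightI, mul_neg, integral_neg]
  rw [rightInt_one_eq_rightI β p.1 hx,
    rightI_congr (zeroExt_congr_ae (ae_eq_neg_rightI_of_mem_fracGraph hp)),
    rightI_zeroExt_of_nonneg hvanish hx.1, hneg, rightI_one_zeroExt, neg_sub]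

variable (P : fracGraph h0 h1)

lemma mul_leftInt_sub_mul_rightInt_eq_inner :
    θ * leftInt 0 β P.1.1 1 - (1 - θ) * rightInt 1 β P.1.1 0 =
      inner ℝ oneL2 (fracOp h0 h1 θ P) := by
  rw [leftInt_zero_of_mem_fracGraph P.2 (right_mem_Icc.2 zero_le_one),
    rightInt_one_of_mem_fracGraph P.2 (left_mem_Icc.2 zero_le_one), leftI_one_zeroExt_one,
    leftI_one_zeroExt_zero, fracOp_apply, inner_add_right, inner_smul_right, inner_smul_right]
  ring

/-- The weak derivative of the boundary corrected fractional integral of `φ ∈ H₀^{1-β}(0,1)`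
whose right boundary function is the primitive of `k`, and whose left boundary function is its
complement to `1`. -/
def correctedOp (h0 : 0 < β) (h1 : β < 1 / 2) (θ : ℝ) (k : L2) : fracGraph h0 h1 →L[ℝ] L2 :=
  fracOp h0 h1 θ - (innerSL ℝ oneL2 ∘L fracOp h0 h1 θ).smulRight k

lemma correctedOp_apply (k : L2) :
    correctedOp h0 h1 θ k P = fracOp h0 h1 θ P - (inner ℝ oneL2 (fracOp h0 h1 θ P) : ℝ) • k := rfl

lemma boundaryCorrected_ae_eq {k : L2} {p q : ℝ → ℝ}
    (hp : p =ᵐ[vol01] fun x => 1 - primitive k x) (hq : q =ᵐ[vol01] primitive k) :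
    boundaryCorrected β θ p q P.1.1 =ᵐ[vol01] primitive (correctedOp h0 h1 θ k P) := by
  have h0mem : (0 : ℝ) ∈ Icc (0 : ℝ) 1 := left_mem_Icc.2 zero_le_one
  have h1mem : (1 : ℝ) ∈ Icc (0 : ℝ) 1 := right_mem_Icc.2 zero_le_one
  filter_upwards [hp, hq, coeFn_primitive k, coeFn_primitive (correctedOp h0 h1 θ k P),
    ae_restrict_mem measurableSet_Ioo] with x hpx hqx hk hP hx
  have hx01 := Ioo_subset_Icc_self hx
  rw [boundaryCorrected, twoSidedInt, leftInt_zero_of_mem_fracGraph P.2 hx01,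
    rightInt_one_of_mem_fracGraph P.2 hx01, leftInt_zero_of_mem_fracGraph P.2 h1mem,
    rightInt_one_of_mem_fracGraph P.2 h0mem, hpx, hqx, hk, hP, leftI_one_zeroExt_one,
    leftI_one_zeroExt_zero, correctedOp_apply, fracOp_apply]
  simp only [leftI_zeroExt_eq_inner (by norm_num : (1 / 2 : ℝ) < 1) le_rfl, inner_sub_right,
    inner_add_right, inner_smul_right]
  ring

omit P in
lemma exists_mem_H0_boundaryCorrected_ae_eq_iff {k γ : L2} {p q : ℝ → ℝ}
    (hp : p =ᵐ[vol01] fun x => 1 - primitive k x) (hq : q =ᵐ[vol01] primitive k) {φ : L2} :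
    φ ∈ H0 (1 - β) ∧ boundaryCorrected β θ p q φ =ᵐ[vol01] primitive γ ↔
      ∃ P, P.1.1 = φ ∧ correctedOp h0 h1 θ k P = γ := by
  have hiff (P : fracGraph h0 h1) : boundaryCorrected β θ p q P.1.1 =ᵐ[vol01] primitive γ ↔
      correctedOp h0 h1 θ k P = γ := by
    rw [← primitive_injective.eq_iff, Lp.ext_iff]
    exact ⟨(boundaryCorrected_ae_eq P hp hq).symm.trans, (boundaryCorrected_ae_eq P hp hq).trans⟩
  rw [mem_H0_one_sub_iff h0 h1]
  constructor
  · rintro ⟨⟨d, hd⟩, h⟩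
    exact ⟨⟨_, hd⟩, rfl, (hiff _).1 h⟩
  · rintro ⟨P, rfl, hP⟩
    exact ⟨⟨P.1.2, P.2⟩, (hiff P).2 hP⟩

lemma isCorrector_smul_oneL2_add_primitive_iff (h0 : 0 < β) (h1 : β < 1 / 2) {p q : ℝ} {k u : L2}
    {wc : ℝ → ℝ} (hwc : ∀ x, wc x = p + (q - p) * x) :
    IsCorrector β θ (p • oneL2 + (q - p) • primitive k) wc u ↔
      ∃ P, P.1.1 = u ∧ correctedOp h0 h1 θ oneL2 P = (q - p) • (k - oneL2) := by
  have hw := coeFn_sub_affine_ae_eq p q k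
  simp only [← hwc] at hw
  rw [← exists_mem_H0_boundaryCorrected_ae_eq_iff (p := fun x => 1 - x) (q := fun x => x)
    (coeFn_primitive_oneL2.mono fun x hx => by simp only [hx]) coeFn_primitive_oneL2.symm]
  exact and_congr_right fun _ => ⟨fun h => h.trans hw, fun h => h.trans hw.symm⟩

section

variable (hθ0 : 0 ≤ θ) (hθ1 : θ ≤ 1)

include hθ0 hθ1

lemma existsUnique_correctedOp_oneL2_eq {γ : L2} (hγ : inner ℝ oneL2 γ = 0) :
    ∃! P, correctedOp h0 h1 θ oneL2 P = γ := by
  obtain ⟨P, c, hP⟩ := exists_fracOp_eq_add_smul (h0 := h0) (h1 := h1) hθ0 hθ1 γ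
  refine ⟨P, ?_, fun Q (hQ : correctedOp h0 h1 θ oneL2 Q = γ) => sub_eq_zero.1
    (eq_zero_of_fracOp_eq_smul hθ0 hθ1 (c := inner ℝ oneL2 (fracOp h0 h1 θ Q) - c) ?_)⟩
  · simp only [correctedOp_apply, hP, inner_add_right, hγ, inner_smul_right, inner_oneL2_self,
      zero_add, mul_one, add_sub_cancel_right]
  · rw [map_sub, hP, ← hQ, correctedOp_apply]
    module

lemma exists_correctedOp_eq {k γ : L2} {P : fracGraph h0 h1}
    (hP : correctedOp h0 h1 θ oneL2 P = oneL2 - k)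
    (hne : 1 + inner ℝ oneL2 (fracOp h0 h1 θ P) ≠ 0) (hγ : inner ℝ oneL2 γ = 0) :
    ∃ Q, correctedOp h0 h1 θ k Q = γ := by
  obtain ⟨P₀, hP₀, -⟩ := existsUnique_correctedOp_oneL2_eq (h0 := h0) (h1 := h1) hθ0 hθ1 hγ
  simp only [correctedOp_apply] at hP hP₀ ⊢
  set τ : ℝ := inner ℝ oneL2 (fracOp h0 h1 θ P)
  set τ₀ : ℝ := inner ℝ oneL2 (fracOp h0 h1 θ P₀)
  set s := -τ₀ / (1 + τ)
  have hs : τ₀ + s * (1 + τ) = 0 := by rw [div_mul_cancel₀ _ hne, add_neg_cancel]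
  refine ⟨P₀ + s • P, ?_⟩
  calc fracOp h0 h1 θ (P₀ + s • P) - (inner ℝ oneL2 (fracOp h0 h1 θ (P₀ + s • P)) : ℝ) • k
    _ = (fracOp h0 h1 θ P₀ - τ₀ • oneL2) + s • (fracOp h0 h1 θ P - τ • oneL2 - (oneL2 - k)) +
        (τ₀ + s * (1 + τ)) • (oneL2 - k) := by
      rw [map_add, map_smul, inner_add_right, inner_smul_right]
      module
    _ = γ := by rw [hP₀, hP, hs, sub_self, smul_zero, zero_smul, add_zero, add_zero]

lemma existsUnique_isCorrector (h0 : 0 < β) (h1 : β < 1 / 2) {p q : ℝ} {k : L2} {wc : ℝ → ℝ}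
    (hk : inner ℝ oneL2 k = 1) (hwc : ∀ x, wc x = p + (q - p) * x) :
    ∃! u, IsCorrector β θ (p • oneL2 + (q - p) • primitive k) wc u := by
  obtain ⟨P, hP, hunique⟩ := existsUnique_correctedOp_oneL2_eq (h0 := h0) (h1 := h1) hθ0 hθ1
    (γ := (q - p) • (k - oneL2))
    (by rw [inner_smul_right, inner_sub_right, hk, inner_oneL2_self, sub_self, mul_zero])
  simp only [isCorrector_smul_oneL2_add_primitive_iff h0 h1 hwc]
  refine ⟨P.1.1, ⟨P, rfl, hP⟩, ?_⟩
  rintro _ ⟨Q, rfl, hQ⟩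
  rw [hunique Q hQ]

lemma spaceV_eq_H0_one {k : L2} {P : fracGraph h0 h1}
    (hP : correctedOp h0 h1 θ oneL2 P = oneL2 - k)
    (hne : 1 + inner ℝ oneL2 (fracOp h0 h1 θ P) ≠ 0) :
    spaceV β θ (oneL2 - primitive k : L2) (primitive k) = H0 1 := by
  have hwl : ⇑(oneL2 - primitive k) =ᵐ[vol01] fun x => 1 - primitive k x := by
    filter_upwards [Lp.coeFn_sub oneL2 (primitive k), coeFn_oneL2] with x hsub hone
    rw [hsub, Pi.sub_apply, hone]
  refine Subset.antisymm (fun _ hg => hg.1) fun g hg => ⟨hg, ?_⟩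
  obtain ⟨γ, hγ, rfl⟩ := exists_eq_primitive_of_mem_H0_one hg
  obtain ⟨Q, hQ⟩ := exists_correctedOp_eq hθ0 hθ1 hP hne hγ
  exact ⟨Q.1.1, (exists_mem_H0_boundaryCorrected_ae_eq_iff hwl .rfl).2 ⟨Q, rfl, hQ⟩⟩

end

end Correctors

end TwoSidedFDE

end

theorem theorem6p2 (β θ : ℝ) (hβ0 : 0 < β) (hβ1 : β < 1 / 2) (hθ0 : 0 ≤ θ) (hθ1 : θ ≤ 1)
    (K : ℝ → ℝ) (Km KM : ℝ) (hKmeas : AEMeasurable K TwoSidedFDE.vol01) (hKm : 0 < Km)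
    (hK : ∀ᵐ x ∂TwoSidedFDE.vol01, Km ≤ K x ∧ K x ≤ KM) :
    -- the functions `w_l` and `w_r` are well defined
    (∃! wl : TwoSidedFDE.L2, TwoSidedFDE.IsWeakSolution K 1 0 wl) ∧
    (∃! wr : TwoSidedFDE.L2, TwoSidedFDE.IsWeakSolution K 0 1 wr) ∧
    ∀ wl wr : TwoSidedFDE.L2,
      TwoSidedFDE.IsWeakSolution K 1 0 wl → TwoSidedFDE.IsWeakSolution K 0 1 wr →
      -- the functions `u_l` and `u_r` are well defined
      (∃! ul : TwoSidedFDE.L2, TwoSidedFDE.IsCorrector β θ wl (fun x => 1 - x) ul) ∧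
      (∃! ur : TwoSidedFDE.L2, TwoSidedFDE.IsCorrector β θ wr (fun x => x) ur) ∧
      ∀ ul ur : TwoSidedFDE.L2,
        TwoSidedFDE.IsCorrector β θ wl (fun x => 1 - x) ul →
        TwoSidedFDE.IsCorrector β θ wr (fun x => x) ur →
        (1 + θ * TwoSidedFDE.leftInt 0 β ul 1 - (1 - θ) * TwoSidedFDE.rightInt 1 β ul 0 ≠ 0 ↔
          1 - θ * TwoSidedFDE.leftInt 0 β ur 1 + (1 - θ) * TwoSidedFDE.rightInt 1 β ur 0 ≠ 0) ∧
        (1 + θ * TwoSidedFDE.leftInt 0 β ul 1 - (1 - θ) * TwoSidedFDE.rightInt 1 β ul 0 ≠ 0 →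
          TwoSidedFDE.spaceV β θ wl wr = TwoSidedFDE.H0 1) := by
  open TwoSidedFDE in
  obtain ⟨k, hk1, hk⟩ := exists_forall_isWeakSolution_iff hKmeas hKm hK
  simp only [hk, existsUnique_eq, true_and]
  rintro _ _ rfl rfl
  have hl (x : ℝ) : 1 - x = 1 + (0 - 1) * x := by ring
  have hr (x : ℝ) : x = 0 + (1 - 0) * x := by ring
  refine ⟨existsUnique_isCorrector hθ0 hθ1 hβ0 hβ1 hk1 hl,
    existsUnique_isCorrector hθ0 hθ1 hβ0 hβ1 hk1 hr, fun ul ur hul hur => ?_⟩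
  obtain ⟨P, rfl, hP⟩ := (isCorrector_smul_oneL2_add_primitive_iff hβ0 hβ1 hl).1 hul
  obtain ⟨Q, rfl, hQ⟩ := (isCorrector_smul_oneL2_add_primitive_iff hβ0 hβ1 hr).1 hur
  rw [show (0 - 1 : ℝ) • (k - oneL2) = oneL2 - k by module] at hP
  rw [show (1 - 0 : ℝ) • (k - oneL2) = k - oneL2 by module] at hQ
  obtain rfl : Q = -P := (existsUnique_correctedOp_oneL2_eq hθ0 hθ1
    (by rw [inner_sub_right, hk1, inner_oneL2_self, sub_self])).unique hQ
    (by rw [map_neg, hP, neg_sub])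
  simp only [add_sub_assoc, sub_add, mul_leftInt_sub_mul_rightInt_eq_inner, map_neg,
    inner_neg_right, sub_neg_eq_add, true_and]
  rw [show (1 : ℝ) • oneL2 + (0 - 1 : ℝ) • primitive k = oneL2 - primitive k by module,
    show (0 : ℝ) • oneL2 + (1 - 0 : ℝ) • primitive k = primitive k by module]
  exact spaceV_eq_H0_one hθ0 hθ1 hP
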